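/- Let $k\ge 3$ and $m\ge 2$ be integers and let $G$ be a $k$-uniform unicyclic hypergraph (with a finite vertex set) that has exactly $m$ edges. Then \[ \rho_{\mathcal{ABC}}(G)\le \sqrt[k]{m-1+\frac{2}{m}}, \] with equality if and only if $G\cong U^{(k)}_{m,2}$. Here the following terminology is used. A hypergraph is $k$-uniform if each of its edges is a set of exactly $k$ vertices. It is connected if any two of its vertices are joined by a path. A cycle is a set of distinct vertices $v_1,\dots,v_\ell$ together with a set of distinct edges $e_1,\dots,e_\ell$, for some $\ell\ge 2$, such that $\{v_i,v_{i+1}\}\subseteq e_i$ for $i=1,\dots,\ell$ (indices modulo $\ell$) and $e_i\cap e_j=\emptyset$ whenever $i\neq j$ are not cyclically consecutive; two cycles are the same if they have the same vertex set $\{v_1,\dots,v_\ell\}$ and the same edge set $\{e_1,\dots,e_\ell\}$. A hypergraph is unicyclic if it is connected and has exactly one cycle. Writing $d_i$ for the degree of the vertex $i$ (the number of edges that contain $i$), the ABC tensor of a $k$-uniform hypergraph $G$ with vertex set $V$ is the tensor of order $k$ with entries \[ \mathcal{ABC}(G)_{i_1,\dots,i_k}=\frac{1}{(k-1)!}\sqrt[k]{\frac{\sum_{i\in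 e}d_i-k}{\prod_{i\in e}d_i}}\quad\text{if } e=\{i_1,\dots,i_k\}\text{ is an edge of } G, \] and $\mathcal{ABC}(G)_{i_1,\dots,i_k}=0$ otherwise, for $i_1,\dots,i_k\in V$. A number $\lambda\in\mathbb{C}$ is an eigenvalue of a real tensor $\mathcal{T}$ of order $k$ indexed by $V$ if there is a nonzero $x\in\mathbb{C}^V$ with $\sum_{i_2,\dots,i_k\in V}\mathcal{T}_{i,i_2,\dots,i_k}x_{i_2}\cdots x_{i_k}=\lambda x_i^{k-1}$ for all $i\in V$, and the ABC spectral radius $\rho_{\mathcal{ABC}}(G)$ is the maximum modulus of the eigenvalues of $\mathcal{ABC}(G)$. Finally, $U^{(k)}_{m,2}$ is the $k$-uniform hypergraph obtained from the hypercycle of length $2$, which has the $2(k-1)$ vertices $v_1,\dots,v_{2k-2}$ and the two edges $\{v_1,\dots,v_k\}$ and $\{v_k,\dots,v_{2k-2},v_1\}$, by adding $m-2$ pendant edges at a vertex of degree $2$, each of which consists of that vertex and of $k-1$ new vertices of degree one. -/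

import Mathlib

/-! ### Real tensors and their spectral radius -/

/-- A real tensor of order `k` (with `k ≥ 1`) whose indices run over `ι`: the entry
`T_{i₁ i₂ … iₖ}` is `T i₁ ![i₂, …, iₖ]`. -/
abbrev RealTensor (ι : Type*) (k : ℕ) : Type _ := ι → (Fin (k - 1) → ι) → ℝ

namespace RealTensor

/-- The vector `T x^{k-1}`, for a complex vector `x`:
`(T x^{k-1})_i = ∑_{i₂, …, iₖ} T_{i i₂ … iₖ} x_{i₂} ⋯ x_{iₖ}`. -/
noncomputable def apply {ι : Type*} [Fintype ι] {k : ℕ} (T : RealTensor ι k) (x : ι → ℂ) :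
    ι → ℂ :=
  fun i => ∑ j : Fin (k - 1) → ι, (T i j : ℂ) * ∏ s, x (j s)

/-- `z` is an eigenvalue of `T`: the system `T x^{k-1} = z x^{[k-1]}` has a nonzero complex
solution. -/
def IsEigenvalue {ι : Type*} [Fintype ι] {k : ℕ} (T : RealTensor ι k) (z : ℂ) : Prop :=
  ∃ x : ι → ℂ, x ≠ 0 ∧ ∀ i, T.apply x i = z * x i ^ (k - 1)

/-- The moduli of the eigenvalues are bounded, so that the supremum below is a genuine one. -/
theorem bddAbove_eigenvalues {ι : Type*} [Fintype ι] {k : ℕ} (T : RealTensor ι k) :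
    BddAbove {r : ℝ | ∃ z : ℂ, T.IsEigenvalue z ∧ r = ‖z‖} := by
  refine ⟨∑ i, ∑ j, |T i j|, ?_⟩
  rintro r ⟨z, ⟨x, hx, h⟩, rfl⟩
  obtain ⟨i₀, hi₀⟩ : ∃ i, x i ≠ 0 := by
    by_contra hcon
    push Not at hcon
    exact hx (funext hcon)
  obtain ⟨i, -, hi⟩ := Finset.exists_max_image Finset.univ (fun i => ‖x i‖) ⟨i₀, Finset.mem_univ _⟩
  have hpos : 0 < ‖x i‖ := lt_of_lt_of_le (norm_pos_iff.mpr hi₀) (hi i₀ (Finset.mem_univ _))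
  have h1 : ‖z‖ * ‖x i‖ ^ (k - 1) ≤ (∑ j, |T i j|) * ‖x i‖ ^ (k - 1) := by
    rw [← norm_pow, ← norm_mul, ← h i, Finset.sum_mul]
    refine (norm_sum_le _ _).trans (Finset.sum_le_sum fun j _ => ?_)
    rw [norm_mul, Complex.norm_real, Real.norm_eq_abs, norm_pow, norm_prod]
    refine mul_le_mul_of_nonneg_left ?_ (abs_nonneg _)
    refine (Finset.prod_le_prod (fun _ _ => norm_nonneg _)
      (fun s _ => hi (j s) (Finset.mem_univ _))).trans ?_
    simp
  refine (le_of_mul_le_mul_right h1 (pow_pos hpos _)).trans ?_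
  exact Finset.single_le_sum (f := fun i => ∑ j, |T i j|)
    (fun i _ => Finset.sum_nonneg fun j _ => abs_nonneg _) (Finset.mem_univ i)

/-- The spectral radius of `T`: the maximum modulus of its eigenvalues. -/
noncomputable def spectralRadius {ι : Type*} [Fintype ι] {k : ℕ} (T : RealTensor ι k) : ℝ :=
  sSup {r : ℝ | ∃ z : ℂ, T.IsEigenvalue z ∧ r = ‖z‖}

end RealTensor

namespace Hypergraph

/-! ### Uniform hypergraphs, connectedness and cycles -/

/-- Every edge has exactly `k` vertices (used for `k ≥ 1` only). -/
def IsUniform {α : Type*} (G : Hypergraph α) (k : ℕ) : Prop :=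
  ∀ e ∈ G.edgeSet, e.ncard = k

/-- The degree of a vertex: the number of edges containing it. -/
noncomputable def degree {α : Type*} (G : Hypergraph α) (v : α) : ℕ :=
  {e ∈ G.edgeSet | v ∈ e}.ncard

/-- There is at least one vertex, and any two vertices are joined by a chain of vertices in which
consecutive ones lie in a common edge. (A shortest such chain has distinct vertices and distinct
edges, and non-consecutive edges of it are disjoint.) -/
def IsConnected {α : Type*} (G : Hypergraph α) : Prop :=
  G.vertexSet.Nonempty ∧
    ∀ u ∈ G.vertexSet, ∀ v ∈ G.vertexSet, Relation.ReflTransGen G.Adj u v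

/-- The pair `C` of a set of vertices and a set of edges is a cycle of `G`: for some `ℓ ≥ 2` it
consists of distinct vertices `v₁, …, v_ℓ` and distinct edges `e₁, …, e_ℓ`, indexed cyclically,
with `v_i, v_{i+1} ∈ e_i` for all `i`, and with `e_i ∩ e_j = ∅` whenever `i` and `j` are neither
equal nor cyclically consecutive. -/
def IsCycle {α : Type*} (G : Hypergraph α) (C : Set α × Set (Set α)) : Prop :=
  ∃ ℓ : ℕ, 2 ≤ ℓ ∧ ∃ (v : ZMod ℓ → α) (e : ZMod ℓ → Set α),
    Function.Injective v ∧ Function.Injective e ∧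
    (∀ i, e i ∈ G.edgeSet) ∧ (∀ i, v i ∈ e i ∧ v (i + 1) ∈ e i) ∧
    (∀ i j, i ≠ j → j ≠ i + 1 → i ≠ j + 1 → Disjoint (e i) (e j)) ∧
    C = (Set.range v, Set.range e)

/-- A unicyclic hypergraph is a connected hypergraph with exactly one cycle. -/
def IsUnicyclic {α : Type*} (G : Hypergraph α) : Prop :=
  G.IsConnected ∧ ∃! C : Set α × Set (Set α), G.IsCycle C

/-- Isomorphism of hypergraphs: a bijection between the vertex sets under which a set of vertices
is an edge if and only if its image is an edge. -/
def IsIsomorphic {α β : Type*} (G : Hypergraph α) (H : Hypergraph β) : Prop :=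
  ∃ σ : G.vertexSet ≃ H.vertexSet, ∀ s : Set G.vertexSet,
    Subtype.val '' s ∈ G.edgeSet ↔ Subtype.val '' (σ '' s) ∈ H.edgeSet

/-! ### The ABC tensor -/

/-- The weight `((∑_{v ∈ e} d_v - k) / ∏_{v ∈ e} d_v)^{1/k}` of an edge `e`. -/
noncomputable def abcWeight {α : Type*} (G : Hypergraph α) (k : ℕ) (e : Set α) : ℝ :=
  (((∑ᶠ v ∈ e, (G.degree v : ℝ)) - k) / ∏ᶠ v ∈ e, (G.degree v : ℝ)) ^ ((1 : ℝ) / k)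

open Classical in
/-- The ABC tensor of a `k`-uniform hypergraph: the entry with indices `i₁, …, iₖ` is
`1 / (k - 1)!` times the weight of `e` if `e = {i₁, …, iₖ}` is an edge, and `0` otherwise. -/
noncomputable def abcTensor {α : Type*} (G : Hypergraph α) (k : ℕ) :
    RealTensor G.vertexSet k :=
  fun i j =>
    let e : Set α := insert (i : α) (Set.range fun s => (j s : α))
    if e ∈ G.edgeSet then 1 / ((k - 1).factorial : ℝ) * G.abcWeight k e else 0

/-- The ABC spectral radius of a `k`-uniform hypergraph. -/
noncomputable def abcSpectralRadius {α : Type*} (G : Hypergraph α) [Fintype G.vertexSet]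
    (k : ℕ) : ℝ :=
  (G.abcTensor k).spectralRadius

/-! ### The extremal hypergraph -/

/-- The `k`-uniform hypercycle of length `g` (for `g ≥ 2`, `k ≥ 3`), with its `g (k - 1)` vertices
numbered cyclically from `0`; for `i < g` the `i`-th edge is
`{i (k - 1), i (k - 1) + 1, …, (i + 1) (k - 1)}`. -/
def hypercycle (g k : ℕ) : Hypergraph (ZMod (g * (k - 1))) where
  vertexSet := Set.univ
  edgeSet := {e | ∃ i < g, e = (fun t : ℕ => ((i * (k - 1) + t : ℕ) : ZMod (g * (k - 1)))) ''
    Set.Iic (k - 1)}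
  subset_vertexSet_of_mem_edgeSet' := fun _ _ => Set.subset_univ _

/-- The hypergraph obtained from `G` by adding `p` new pendant edges of size `k` at the vertex
`u`; the `j`-th new edge consists of `u` and of the `k - 1` new vertices `(j, s)`. -/
def addPendantEdges {α : Type*} (G : Hypergraph α) (u : α) (p k : ℕ) :
    Hypergraph (α ⊕ Fin p × Fin (k - 1)) where
  vertexSet := insert (Sum.inl u) (Sum.inl '' G.vertexSet ∪ Set.range Sum.inr)
  edgeSet := {e | (∃ f ∈ G.edgeSet, e = Sum.inl '' f) ∨
    ∃ j : Fin p, e = insert (Sum.inl u) (Set.range fun s => Sum.inr (j, s))}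
  subset_vertexSet_of_mem_edgeSet' := by
    rintro e (⟨f, hf, rfl⟩ | ⟨j, rfl⟩)
    · rintro _ ⟨x, hx, rfl⟩
      exact Or.inr (Or.inl ⟨x, G.subset_vertexSet_of_mem_edgeSet hf hx, rfl⟩)
    · rintro x (rfl | ⟨s, rfl⟩)
      · exact Or.inl rfl
      · exact Or.inr (Or.inr ⟨_, rfl⟩)

/-- `U_{m,g}^{(k)}`: the hypercycle of length `g` with `m - g` pendant edges added at a vertex of
degree `2`, namely the vertex `0`, which lies in the first and in the last edge of the cycle. -/
def extremalUnicyclic (k m g : ℕ) :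
    Hypergraph (ZMod (g * (k - 1)) ⊕ Fin (m - g) × Fin (k - 1)) :=
  (hypercycle g k).addPendantEdges 0 (m - g) k

end Hypergraph

/-! The proof bounds eigenvalues by weighted vertex-edge labels. Let `L = m - 1 + 2/m`, and call `∑
v ∈ e, d_v - k = ∑ v ∈ e, (d_v - 1)` the excess of an edge `e`. Suppose that nonnegative labels `b v
e` sum to at most `d_v` at each vertex and that each excess is at most `L * ∏ v ∈ e, b v e`. Then
AM-GM on each edge shows that every eigenvalue has modulus at most `L^(1/k)`
(`norm_le_of_labelling`). If all edge inequalities are strict, `L` can be lowered, so the bound is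
strict.

The excess of `e` equals `∑ f ≠ e, |e ∩ f|`. With only one cycle, at most one pair of edges shares
two vertices, and no pair shares more, so every excess is at most `m`. If all are at most `m - 1 <
L`, the labels `1` suffice. Otherwise some `e₁` has excess `m`: it meets every other edge, one of
them, `e₂`, in two vertices `u`, `w`, and other edges meet only inside `e₁`
(`HasFewCycles.exists_isDominatedBy`). Explicit strict labels exist if a vertex of `e₁` outside `e₂`
has degree at least two, or if `u` and `w` both have degree at least three. What remains is
precisely `U_{m,2}`.

For the extremal hypergraph, positive edge numbers `q e` make all inequalities tight. They give both
an optimal labelling and a positive eigenvector for `L^(1/k)` (`IsExtremal.exists_consistent`,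
`exists_eigenvector`). Finally, the combinatorial description `IsExtremal` determines the hypergraph
up to isomorphism. -/

open Finset

/-! ### The hypergraph as a finset of finsets of vertices -/

namespace Finset

/-- The number of members of `𝓔` that contain `v`. -/
def memberDegree {V : Type*} [DecidableEq V] (𝓔 : Finset (Finset V)) (v : V) : ℕ :=
  #{e ∈ 𝓔 | v ∈ e}

/-- The ABC weight of a set of vertices with respect to a family of edges. -/
noncomputable def memberWeight {V : Type*} [DecidableEq V] (𝓔 : Finset (Finset V)) (k : ℕ)
    (e : Finset V) : ℝ :=
  (((∑ v ∈ e, (𝓔.memberDegree v : ℝ)) - k) / ∏ v ∈ e, (𝓔.memberDegree v : ℝ)) ^ ((1 : ℝ) / k)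

/-- A tuple of length `#t` that exhausts `t` is a bijection onto `t`. This count cancels the factor
`1 / (k - 1)!` of the ABC tensor. -/
theorem card_filter_image_univ_eq {V : Type*} [Fintype V] [DecidableEq V] {n : ℕ}
    (t : Finset V) (ht : #t = n) :
    #{j : Fin n → V | univ.image j = t} = n.factorial := by
  have hc : Fintype.card (Fin n ≃ t) = n.factorial := by
    rw [Fintype.card_equiv (Fintype.equivOfCardEq (by simp [ht]))]
    simp
  rw [← hc, ← Finset.card_univ]
  symm
  refine Finset.card_bij (fun σ _ => fun s => (σ s : V)) ?_ ?_ ?_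
  · intro σ _
    rw [Finset.mem_filter]
    refine ⟨mem_univ _, ?_⟩
    ext v
    simp only [mem_image, mem_univ, true_and]
    constructor
    · rintro ⟨a, rfl⟩
      exact (σ a).2
    · intro hv
      exact ⟨σ.symm ⟨v, hv⟩, by simp⟩
  · intro σ _ τ _ h
    ext s
    exact congrFun h s
  · intro j hj
    rw [Finset.mem_filter] at hj
    have hmem : ∀ s, j s ∈ t := fun s => hj.2 ▸ mem_image_of_mem _ (mem_univ s)
    refine ⟨Equiv.ofBijective (fun s => (⟨j s, hmem s⟩ : t)) ?_, mem_univ _, rfl⟩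
    rw [Fintype.bijective_iff_surjective_and_card]
    refine ⟨?_, by simp [ht]⟩
    rintro ⟨v, hv⟩
    rw [← hj.2, mem_image] at hv
    obtain ⟨s, -, hs⟩ := hv
    exact ⟨s, Subtype.ext hs⟩

/-- A set `s` with `n + 1` elements is `{i, j 0, …, j (n - 1)}` exactly if the `j`'s exhaust
`s \ {i}`. -/
theorem insert_image_univ_eq_iff {V : Type*} [DecidableEq V] {n : ℕ} (s : Finset V)
    (hs : #s = n + 1) (i : V) (hi : i ∈ s) (j : Fin n → V) :
    insert i (univ.image j) = s ↔ univ.image j = s.erase i := by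
  constructor
  · intro h
    have h1 : s.erase i ⊆ univ.image j := by
      intro v hv
      rw [mem_erase] at hv
      have := h ▸ hv.2
      rw [mem_insert] at this
      exact this.resolve_left hv.1
    refine (Finset.eq_of_subset_of_card_le h1 ?_).symm
    rw [card_erase_of_mem hi, hs]
    exact card_image_le.trans (by simp)
  · intro h
    rw [h, insert_erase hi]

theorem prod_comp_of_image_univ_eq {V : Type*} [DecidableEq V] {n : ℕ} (t : Finset V)
    (ht : #t = n) (j : Fin n → V) (hj : univ.image j = t) (x : V → ℂ) :
    ∏ s, x (j s) = ∏ v ∈ t, x v := by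
  have hinj : Set.InjOn j (univ : Finset (Fin n)) := by
    rw [← Finset.card_image_iff, hj, ht]
    simp
  rw [← hj, Finset.prod_image hinj]

end Finset

/-! ### The ABC tensor as a sum over edges -/

namespace Hypergraph

open Classical in
/-- The edges of `G`, as finsets of vertices. -/
noncomputable def finsetEdges {α : Type*} (G : Hypergraph α) [Fintype G.vertexSet] :
    Finset (Finset G.vertexSet) :=
  {s | Subtype.val '' (s : Set G.vertexSet) ∈ G.edgeSet}

section

variable {α : Type*} (G : Hypergraph α) [Fintype G.vertexSet]

theorem mem_finsetEdges {s : Finset G.vertexSet} :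
    s ∈ G.finsetEdges ↔ Subtype.val '' (s : Set G.vertexSet) ∈ G.edgeSet := by
  simp [finsetEdges]

theorem exists_finsetEdges {e : Set α} (he : e ∈ G.edgeSet) :
    ∃ s ∈ G.finsetEdges, Subtype.val '' (s : Set G.vertexSet) = e := by
  classical
  have h : Subtype.val '' ((univ.filter fun v : G.vertexSet => (v : α) ∈ e : Finset G.vertexSet) :
      Set G.vertexSet) = e := by
    ext x
    simp only [coe_filter, mem_univ, true_and, Set.mem_image, Set.mem_ofPred_eq, Subtype.exists,
      exists_and_left, exists_prop, exists_eq_right_right]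
    exact ⟨fun h => h.1, fun h => ⟨h, G.subset_vertexSet_of_mem_edgeSet he h⟩⟩
  exact ⟨_, G.mem_finsetEdges.2 (h.symm ▸ he), h⟩

omit [Fintype G.vertexSet] in
theorem image_val_injective :
    Function.Injective fun s : Finset G.vertexSet => Subtype.val '' (s : Set G.vertexSet) :=
  fun _ _ h => Finset.coe_injective (Set.image_injective.2 Subtype.val_injective h)

theorem card_finsetEdges : #G.finsetEdges = G.edgeSet.ncard := by
  rw [← Set.ncard_coe_finset, ← Set.ncard_image_of_injective _ G.image_val_injective]
  congr 1
  ext e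
  constructor
  · rintro ⟨s, hs, rfl⟩
    exact G.mem_finsetEdges.1 hs
  · intro he
    obtain ⟨s, hs, rfl⟩ := G.exists_finsetEdges he
    exact ⟨s, hs, rfl⟩

theorem card_of_mem_finsetEdges {k : ℕ} (h : G.IsUniform k) {s : Finset G.vertexSet}
    (hs : s ∈ G.finsetEdges) : #s = k := by
  rw [← h _ (G.mem_finsetEdges.1 hs), Set.ncard_image_of_injective _ Subtype.val_injective,
    Set.ncard_coe_finset]

theorem degree_eq_memberDegree [DecidableEq G.vertexSet] (v : G.vertexSet) :
    G.degree v = G.finsetEdges.memberDegree v := by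
  rw [memberDegree, ← Set.ncard_coe_finset, ← Set.ncard_image_of_injective _ G.image_val_injective,
    degree]
  congr 1
  ext e
  constructor
  · rintro ⟨he, hv⟩
    obtain ⟨s, hs, rfl⟩ := G.exists_finsetEdges he
    exact ⟨s, by simpa [hs] using hv, rfl⟩
  · rintro ⟨s, hs, rfl⟩
    simp only [coe_filter, Set.mem_ofPred_eq] at hs
    exact ⟨G.mem_finsetEdges.1 hs.1, ⟨v, hs.2, rfl⟩⟩

theorem abcWeight_eq_memberWeight [DecidableEq G.vertexSet] (k : ℕ) (s : Finset G.vertexSet) :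
    G.abcWeight k (Subtype.val '' (s : Set G.vertexSet)) = G.finsetEdges.memberWeight k s := by
  rw [abcWeight, memberWeight, finsum_mem_image Subtype.val_injective.injOn,
    finprod_mem_image Subtype.val_injective.injOn, finsum_mem_coe_finset, finprod_mem_coe_finset]
  simp only [degree_eq_memberDegree]

/-- The tuples that complete `i` to an edge `s` are the `(k - 1)!` orderings of `s \ {i}`, all
contributing the same monomial. -/
theorem abcTensor_apply [DecidableEq G.vertexSet] {k : ℕ} (hk : 0 < k) (h : G.IsUniform k)
    (x : G.vertexSet → ℂ) (i : G.vertexSet) :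
    (G.abcTensor k).apply x i =
      ∑ s ∈ G.finsetEdges with i ∈ s,
        (G.finsetEdges.memberWeight k s : ℂ) * ∏ v ∈ s.erase i, x v := by
  obtain ⟨n, rfl⟩ : ∃ n, k = n + 1 := ⟨k - 1, by omega⟩
  have hset : ∀ j : Fin n → G.vertexSet,
      insert (i : α) (Set.range fun s => (j s : α)) =
        Subtype.val '' ((insert i (univ.image j) : Finset G.vertexSet) : Set G.vertexSet) := by
    intro j
    simp [Set.image_insert_eq, ← Set.range_comp, Function.comp_def]
  have hT : ∀ j : Fin n → G.vertexSet, G.abcTensor (n + 1) i j =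
      if insert i (univ.image j) ∈ G.finsetEdges then
        1 / (n.factorial : ℝ) * G.finsetEdges.memberWeight (n + 1) (insert i (univ.image j))
      else 0 := by
    intro j
    rw [← abcWeight_eq_memberWeight]
    simp only [abcTensor]
    erw [hset j]
    split_ifs with h₁ h₂ h₂
    · rfl
    · exact absurd (G.mem_finsetEdges.2 h₁) h₂
    · exact absurd (G.mem_finsetEdges.1 h₂) h₁
    · rfl
  unfold RealTensor.apply
  -- Group the tuples by the set they form together with `i`. Non-edges contribute zero, and the
  -- fibre over an edge avoiding `i` is empty.
  rw [← Finset.sum_fiberwise (s := univ)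
    (g := fun j : Fin (n + 1 - 1) → G.vertexSet => insert i (univ.image j))]
  rw [Finset.sum_filter, ← Finset.sum_subset (Finset.subset_univ G.finsetEdges)]
  · refine Finset.sum_congr rfl fun s hs => ?_
    have hcard := G.card_of_mem_finsetEdges h hs
    split_ifs with his
    · have hc : #(s.erase i) = n := by rw [card_erase_of_mem his, hcard]; rfl
      have hfil : (univ.filter fun j : Fin (n + 1 - 1) → G.vertexSet =>
          insert i (univ.image j) = s) =
          univ.filter fun j : Fin n → G.vertexSet => univ.image j = s.erase i :=
        Finset.filter_congr fun j _ => insert_image_univ_eq_iff s hcard i his j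
      rw [hfil, Finset.sum_congr rfl (g := fun _ => ((1 / (n.factorial : ℝ) *
        G.finsetEdges.memberWeight (n + 1) s : ℝ) : ℂ) * ∏ v ∈ s.erase i, x v)]
      · rw [Finset.sum_const, card_filter_image_univ_eq _ hc, nsmul_eq_mul]
        have : (n.factorial : ℂ) ≠ 0 := by exact_mod_cast n.factorial_ne_zero
        push_cast
        field_simp
      · intro j hj
        rw [Finset.mem_filter] at hj
        have := (insert_image_univ_eq_iff s hcard i his j).2 hj.2
        rw [hT j, this, if_pos hs]
        erw [prod_comp_of_image_univ_eq _ hc j hj.2 x]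
    · refine Finset.sum_eq_zero fun j hj => absurd ?_ his
      rw [Finset.mem_filter] at hj
      rw [← hj.2]
      exact mem_insert_self _ _
  · intro s _ hs
    refine Finset.sum_eq_zero fun j hj => ?_
    rw [Finset.mem_filter] at hj
    rw [hT j, if_neg (by rw [hj.2]; exact hs)]
    simp

end

end Hypergraph

/-! ### Labellings bound eigenvalues; consistent edge numbers give eigenvectors -/

namespace Finset

variable {V : Type*} [Fintype V] [DecidableEq V] (𝓔 : Finset (Finset V)) {k : ℕ}

theorem sum_sum_filter_mem_comm {M : Type*} [AddCommMonoid M] (F : V → Finset V → M) :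
    ∑ v, ∑ e ∈ 𝓔 with v ∈ e, F v e = ∑ e ∈ 𝓔, ∑ v ∈ e, F v e :=
  Finset.sum_comm' (by simp; tauto)

omit [Fintype V] in
theorem memberDegree_pos {e : Finset V} (he : e ∈ 𝓔) {v : V} (hv : v ∈ e) :
    0 < 𝓔.memberDegree v :=
  Finset.card_pos.2 ⟨e, by simp [he, hv]⟩

omit [Fintype V] in
theorem le_sum_memberDegree {e : Finset V} (he : e ∈ 𝓔) :
    (#e : ℝ) ≤ ∑ v ∈ e, (𝓔.memberDegree v : ℝ) := by
  rw [Finset.card_eq_sum_ones]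
  push_cast
  exact Finset.sum_le_sum fun v hv => by exact_mod_cast 𝓔.memberDegree_pos he hv

omit [Fintype V] in
theorem memberWeight_nonneg (hcard : ∀ e ∈ 𝓔, #e = k) {e : Finset V} (he : e ∈ 𝓔) :
    0 ≤ 𝓔.memberWeight k e := by
  refine Real.rpow_nonneg (div_nonneg (sub_nonneg.2 ?_) (by positivity)) _
  have := 𝓔.le_sum_memberDegree he
  rwa [hcard e he] at this

omit [Fintype V] in
theorem memberWeight_pow (hk : 0 < k) (hcard : ∀ e ∈ 𝓔, #e = k) {e : Finset V} (he : e ∈ 𝓔) :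
    𝓔.memberWeight k e ^ k =
      ((∑ v ∈ e, (𝓔.memberDegree v : ℝ)) - k) / ∏ v ∈ e, (𝓔.memberDegree v : ℝ) := by
  have := 𝓔.le_sum_memberDegree he
  rw [hcard e he] at this
  rw [memberWeight, one_div, Real.rpow_inv_natCast_pow _ hk.ne']
  exact div_nonneg (sub_nonneg.2 this) (by positivity)

omit [Fintype V] [DecidableEq V] in
/-- The inequality between the geometric and the arithmetic mean of `k` numbers. -/
theorem mul_le_sum_of_pow_le_prod (hk : 0 < k) {e : Finset V} (he : #e = k) {a r : ℝ}
    (hr : 0 ≤ r) {y : V → ℝ} (hy : ∀ v ∈ e, 0 ≤ y v)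
    (h : a ^ k ≤ r ^ k * ∏ v ∈ e, y v) : k * a ≤ r * ∑ v ∈ e, y v := by
  have hk' : (0 : ℝ) < k := by exact_mod_cast hk
  have amgm := Real.geom_mean_le_arith_mean_weighted e (fun _ => (1 : ℝ) / k) y
    (fun _ _ => by positivity) (by rw [sum_const, he, nsmul_eq_mul]; field_simp) hy
  rw [← Finset.mul_sum] at amgm
  have h0 : 0 ≤ ∏ v ∈ e, y v ^ ((1 : ℝ) / k) :=
    prod_nonneg fun v hv => Real.rpow_nonneg (hy v hv) _
  have h1 : a ≤ r * ∏ v ∈ e, y v ^ ((1 : ℝ) / k) := by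
    refine le_of_pow_le_pow_left₀ hk.ne' (mul_nonneg hr h0) ?_
    rw [mul_pow, ← Finset.prod_pow]
    refine h.trans_eq ?_
    congr 1
    refine Finset.prod_congr rfl fun v hv => ?_
    rw [one_div, Real.rpow_inv_natCast_pow (hy v hv) hk.ne']
  calc k * a ≤ k * (r * ((1 : ℝ) / k * ∑ v ∈ e, y v)) := by
        refine mul_le_mul_of_nonneg_left (h1.trans ?_) hk'.le
        exact mul_le_mul_of_nonneg_left amgm hr
    _ = r * ∑ v ∈ e, y v := by field_simp

/-- Multiplying the `i`-th equation by `‖x i‖` and summing over `i` counts each edge product `k`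
times. AM-GM distributes it over the vertices of the edge in proportion to the labels, and no vertex
receives more than `‖x v‖ ^ k`. This works for every complex eigenvector, so no Perron-Frobenius
theory is needed. -/
theorem norm_le_of_labelling (hk : 0 < k) (hcard : ∀ e ∈ 𝓔, #e = k) {L : ℝ} (hL : 0 ≤ L)
    (b : V → Finset V → ℝ) (hb : ∀ e ∈ 𝓔, ∀ v ∈ e, 0 ≤ b v e)
    (hsum : ∀ v, ∑ e ∈ 𝓔 with v ∈ e, b v e ≤ 𝓔.memberDegree v)
    (hprod : ∀ e ∈ 𝓔, (∑ v ∈ e, (𝓔.memberDegree v : ℝ)) - k ≤ L * ∏ v ∈ e, b v e)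
    {x : V → ℂ} (hx : x ≠ 0) {z : ℂ}
    (h : ∀ i, ∑ s ∈ 𝓔 with i ∈ s, (𝓔.memberWeight k s : ℂ) * ∏ v ∈ s.erase i, x v =
      z * x i ^ (k - 1)) : ‖z‖ ≤ L ^ ((1 : ℝ) / k) := by
  set r := L ^ ((1 : ℝ) / k) with hr
  have hr0 : 0 ≤ r := Real.rpow_nonneg hL _
  have hrk : r ^ k = L := by rw [hr, one_div, Real.rpow_inv_natCast_pow hL hk.ne']
  have hpos : 0 < ∑ v, ‖x v‖ ^ k := by
    obtain ⟨i, hi⟩ := Function.ne_iff.1 hx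
    exact Finset.sum_pos' (fun v _ => by positivity)
      ⟨i, mem_univ _, pow_pos (norm_pos_iff.2 hi) _⟩
  have hvertex : ∀ i, ‖z‖ * ‖x i‖ ^ k ≤
      ∑ s ∈ 𝓔 with i ∈ s, 𝓔.memberWeight k s * ∏ v ∈ s, ‖x v‖ := by
    intro i
    calc ‖z‖ * ‖x i‖ ^ k = ‖z * x i ^ (k - 1)‖ * ‖x i‖ := by
          rw [norm_mul, norm_pow, mul_assoc, ← pow_succ, Nat.sub_add_cancel hk]
      _ ≤ (∑ s ∈ 𝓔 with i ∈ s, 𝓔.memberWeight k s * ∏ v ∈ s.erase i, ‖x v‖) * ‖x i‖ := by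
          rw [← h i]
          refine mul_le_mul_of_nonneg_right ((norm_sum_le _ _).trans_eq ?_) (norm_nonneg _)
          refine Finset.sum_congr rfl fun s hs => ?_
          rw [Finset.mem_filter] at hs
          rw [norm_mul, norm_prod, Complex.norm_real, Real.norm_eq_abs,
            abs_of_nonneg (𝓔.memberWeight_nonneg hcard hs.1)]
      _ = _ := by
          rw [Finset.sum_mul]
          refine Finset.sum_congr rfl fun s hs => ?_
          rw [Finset.mem_filter] at hs
          rw [mul_assoc, Finset.prod_erase_mul _ _ hs.2]
  -- AM-GM for the numbers `b v s / d_v * ‖x v‖ ^ k`; the hypothesis it needs is `hprod` divided by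
  -- the product of the degrees.
  have hedge : ∀ s ∈ 𝓔, k * (𝓔.memberWeight k s * ∏ v ∈ s, ‖x v‖) ≤
      r * ∑ v ∈ s, b v s / 𝓔.memberDegree v * ‖x v‖ ^ k := by
    intro s hs
    have hd : 0 < ∏ v ∈ s, (𝓔.memberDegree v : ℝ) :=
      Finset.prod_pos fun v hv => by exact_mod_cast 𝓔.memberDegree_pos hs hv
    refine mul_le_sum_of_pow_le_prod hk (hcard s hs) hr0
      (fun v hv => mul_nonneg (div_nonneg (hb s hs v hv) (by positivity)) (by positivity)) ?_
    rw [hrk, mul_pow, 𝓔.memberWeight_pow hk hcard hs, Finset.prod_mul_distrib,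
      Finset.prod_div_distrib, ← Finset.prod_pow, ← mul_assoc, ← mul_div_assoc]
    refine mul_le_mul_of_nonneg_right ?_ (Finset.prod_nonneg fun v _ => by positivity)
    exact div_le_div_of_nonneg_right (hprod s hs) hd.le
  have hcomb : ‖z‖ * (∑ v, ‖x v‖ ^ k) ≤ r * ∑ v, ‖x v‖ ^ k := by
    have hk' : (0 : ℝ) < k := by exact_mod_cast hk
    calc ‖z‖ * (∑ v, ‖x v‖ ^ k)
        ≤ ∑ i, ∑ s ∈ 𝓔 with i ∈ s, 𝓔.memberWeight k s * ∏ v ∈ s, ‖x v‖ := by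
          rw [Finset.mul_sum]
          exact Finset.sum_le_sum fun i _ => hvertex i
      _ = ∑ s ∈ 𝓔, k * (𝓔.memberWeight k s * ∏ v ∈ s, ‖x v‖) := by
          rw [sum_sum_filter_mem_comm]
          refine Finset.sum_congr rfl fun s hs => ?_
          rw [sum_const, hcard s hs, nsmul_eq_mul]
      _ ≤ ∑ s ∈ 𝓔, r * ∑ v ∈ s, b v s / 𝓔.memberDegree v * ‖x v‖ ^ k :=
          Finset.sum_le_sum hedge
      _ = r * ∑ v, ∑ s ∈ 𝓔 with v ∈ s, b v s / 𝓔.memberDegree v * ‖x v‖ ^ k := by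
          rw [sum_sum_filter_mem_comm, Finset.mul_sum]
      _ ≤ r * ∑ v, ‖x v‖ ^ k := by
          refine mul_le_mul_of_nonneg_left (Finset.sum_le_sum fun v _ => ?_) hr0
          rw [← Finset.sum_mul, ← Finset.sum_div]
          refine mul_le_of_le_one_left (by positivity) ?_
          exact div_le_one_of_le₀ (hsum v) (by positivity)
  exact le_of_mul_le_mul_right hcomb hpos

/-- The constant in finitely many strict inequalities may be lowered. -/
theorem exists_lt_forall_le_mul {ι : Type*} (s : Finset ι) (f g : ι → ℝ) {L : ℝ} (hL : 0 < L)
    (hf : ∀ i ∈ s, 0 ≤ f i) (h : ∀ i ∈ s, f i < L * g i) :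
    ∃ L', 0 ≤ L' ∧ L' < L ∧ ∀ i ∈ s, f i ≤ L' * g i := by
  have hg : ∀ i ∈ s, 0 < g i := fun i hi =>
    pos_of_mul_pos_right ((hf i hi).trans_lt (h i hi)) hL.le
  rcases s.eq_empty_or_nonempty with rfl | hs
  · exact ⟨0, le_rfl, hL, by simp⟩
  · obtain ⟨i, hi, hmax⟩ := s.exists_max_image (fun i => f i / g i) hs
    refine ⟨f i / g i, div_nonneg (hf i hi) (hg i hi).le, ?_, fun j hj => ?_⟩
    · rw [div_lt_iff₀ (hg i hi)]
      exact h i hi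
    · rw [← div_le_iff₀ (hg j hj)]
      exact hmax j hj

omit [Fintype V] in
/-- A system of positive numbers `q e` that is consistent with the weights gives the
eigenvector `x v = (∑_{e ∋ v} q e)^{1/k}`. -/
theorem exists_eigenvector (hk₁ : 1 < k) (hcard : ∀ e ∈ 𝓔, #e = k) {L : ℝ} (hL : 0 ≤ L)
    (q : Finset V → ℝ) (hq : ∀ e ∈ 𝓔, 0 < q e) (hne : 𝓔.Nonempty)
    (h : ∀ e ∈ 𝓔, ((∑ v ∈ e, (𝓔.memberDegree v : ℝ)) - k) *
        ∏ v ∈ e, ∑ f ∈ 𝓔 with v ∈ f, q f = L * q e ^ k * ∏ v ∈ e, (𝓔.memberDegree v : ℝ)) :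
    ∃ x : V → ℂ, x ≠ 0 ∧ ∀ i, ∑ s ∈ 𝓔 with i ∈ s, (𝓔.memberWeight k s : ℂ) *
      ∏ v ∈ s.erase i, x v = ((L ^ ((1 : ℝ) / k) : ℝ) : ℂ) * x i ^ (k - 1) := by
  have hk : 0 < k := by omega
  set r := L ^ ((1 : ℝ) / k) with hr
  have hr0 : 0 ≤ r := Real.rpow_nonneg hL _
  have hrk : r ^ k = L := by rw [hr, one_div, Real.rpow_inv_natCast_pow hL hk.ne']
  set y : V → ℝ := fun v => ∑ f ∈ 𝓔 with v ∈ f, q f with hy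
  have hy0 : ∀ v, 0 ≤ y v := fun v =>
    Finset.sum_nonneg fun f hf => (hq f (Finset.mem_filter.1 hf).1).le
  have hypos : ∀ e ∈ 𝓔, ∀ v ∈ e, 0 < y v := fun e he v hv =>
    Finset.sum_pos (fun f hf => hq f (Finset.mem_filter.1 hf).1) ⟨e, by simp [he, hv]⟩
  set x : V → ℝ := fun v => y v ^ ((1 : ℝ) / k) with hx
  have hx0 : ∀ v, 0 ≤ x v := fun v => Real.rpow_nonneg (hy0 v) _
  have hxk : ∀ v, x v ^ k = y v := fun v => by
    simp only [hx]
    rw [one_div, Real.rpow_inv_natCast_pow (hy0 v) hk.ne']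
  have hxpos : ∀ e ∈ 𝓔, ∀ v ∈ e, 0 < x v := fun e he v hv =>
    Real.rpow_pos_of_pos (hypos e he v hv) _
  -- The `k`-th power of this equation is the consistency condition `h`. Summing it over the edges
  -- at `i` and cancelling one `x i` gives the eigenvalue equation.
  have hedge : ∀ e ∈ 𝓔, 𝓔.memberWeight k e * ∏ v ∈ e, x v = r * q e := by
    intro e he
    refine (pow_left_inj₀ ?_ ?_ hk.ne').1 ?_
    · exact mul_nonneg (𝓔.memberWeight_nonneg hcard he) (Finset.prod_nonneg fun v _ => hx0 v)
    · exact mul_nonneg hr0 (hq e he).le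
    · have hd : 0 < ∏ v ∈ e, (𝓔.memberDegree v : ℝ) :=
        Finset.prod_pos fun v hv => by exact_mod_cast 𝓔.memberDegree_pos he hv
      rw [mul_pow, mul_pow, 𝓔.memberWeight_pow hk hcard he, ← Finset.prod_pow, hrk,
        Finset.prod_congr rfl fun v _ => hxk v, div_mul_eq_mul_div, div_eq_iff hd.ne']
      exact h e he
  obtain ⟨e₀, he₀⟩ := hne
  refine ⟨fun v => (x v : ℂ), ?_, fun i => ?_⟩
  · obtain ⟨v, hv⟩ : e₀.Nonempty := by rw [← Finset.card_pos, hcard e₀ he₀]; exact hk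
    intro h0
    exact (hxpos e₀ he₀ v hv).ne' (by simpa using congrFun h0 v)
  · have key : ∑ s ∈ 𝓔 with i ∈ s, 𝓔.memberWeight k s * ∏ v ∈ s.erase i, x v =
        r * x i ^ (k - 1) := by
      by_cases hi : ∃ e ∈ 𝓔, i ∈ e
      · obtain ⟨e, he, hie⟩ := hi
        refine mul_right_cancel₀ (hxpos e he i hie).ne' ?_
        rw [mul_assoc, ← pow_succ, Nat.sub_add_cancel hk, hxk, Finset.sum_mul]
        simp only [hy]
        rw [Finset.mul_sum]
        refine Finset.sum_congr rfl fun s hs => ?_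
        rw [Finset.mem_filter] at hs
        rw [mul_assoc, Finset.prod_erase_mul _ _ hs.2, hedge s hs.1]
      -- At a vertex in no edge both sides vanish, because `k - 1` is positive.
      · have hempty : {e ∈ 𝓔 | i ∈ e} = ∅ :=
          Finset.filter_eq_empty_iff.2 fun e he hie => hi ⟨e, he, hie⟩
        have hxi : x i = 0 := by
          simp only [hx, hy, hempty, Finset.sum_empty]
          exact Real.zero_rpow (by positivity)
        rw [hempty, hxi, zero_pow (by omega), Finset.sum_empty, mul_zero]
    beta_reduce
    exact_mod_cast key

end Finset

/-! ### Edge families with at most one cycle of length two or three -/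

namespace Finset

variable {V : Type*} [DecidableEq V]

/-- At most two members of `𝓔` share two vertices, they share no third one, and there is no
triangle besides. This holds for the edges of a hypergraph with exactly one cycle. -/
structure HasFewCycles (𝓔 : Finset (Finset V)) : Prop where
  card_inter_le : ∀ e ∈ 𝓔, ∀ f ∈ 𝓔, e ≠ f → #(e ∩ f) ≤ 2
  pair_unique : ∀ e ∈ 𝓔, ∀ f ∈ 𝓔, ∀ e' ∈ 𝓔, ∀ f' ∈ 𝓔, e ≠ f → e' ≠ f' →
    2 ≤ #(e ∩ f) → 2 ≤ #(e' ∩ f') → e' = e ∨ e' = f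
  no_triangle : ∀ e ∈ 𝓔, ∀ f ∈ 𝓔, e ≠ f → 2 ≤ #(e ∩ f) → ∀ a ∈ 𝓔, ∀ b ∈ 𝓔, ∀ c ∈ 𝓔,
    a ≠ b → b ≠ c → c ≠ a → ∀ p ∈ a ∩ b, ∀ q ∈ b ∩ c, ∀ r ∈ c ∩ a, p ≠ q → q ≠ r → r ≠ p → False

/-- Vertex-edge labels showing that the ABC spectral radius is less than `L ^ (1 / k)`. -/
def HasStrictLabelling (𝓔 : Finset (Finset V)) (k : ℕ) (L : ℝ) : Prop :=
  ∃ b : V → Finset V → ℝ, (∀ e ∈ 𝓔, ∀ v ∈ e, 0 ≤ b v e) ∧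
    (∀ v, ∑ e ∈ 𝓔 with v ∈ e, b v e ≤ 𝓔.memberDegree v) ∧
    ∀ e ∈ 𝓔, (∑ v ∈ e, (𝓔.memberDegree v : ℝ)) - k < L * ∏ v ∈ e, b v e

/-- The edges of the extremal hypergraph: two edges that share exactly the vertices `u` and `w`,
and further edges attached at `u`, with no other vertex in two edges. -/
def IsExtremal (𝓔 : Finset (Finset V)) (k m : ℕ) : Prop :=
  (∀ e ∈ 𝓔, #e = k) ∧ #𝓔 = m ∧ (∀ v, ∃ e ∈ 𝓔, v ∈ e) ∧
    ∃ u w, u ≠ w ∧ ∃ e₁ ∈ 𝓔, ∃ e₂ ∈ 𝓔, e₁ ≠ e₂ ∧ (∀ e ∈ 𝓔, u ∈ e) ∧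
      (∀ e ∈ 𝓔, w ∈ e ↔ e = e₁ ∨ e = e₂) ∧
      ∀ e ∈ 𝓔, ∀ f ∈ 𝓔, ∀ v ∈ e, v ∈ f → v ≠ u → v ≠ w → e = f

/-- The edge `e₁` meets all other edges, `e₂` in two vertices and the others in one, and two
other edges meet only within `e₁`. -/
structure IsDominatedBy (𝓔 : Finset (Finset V)) (e₁ e₂ : Finset V) : Prop where
  left_mem : e₁ ∈ 𝓔
  right_mem : e₂ ∈ 𝓔
  ne : e₂ ≠ e₁
  card_inter : #(e₁ ∩ e₂) = 2
  card_inter_other : ∀ f ∈ 𝓔, f ≠ e₁ → f ≠ e₂ → #(e₁ ∩ f) = 1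
  inter_subset : ∀ f ∈ 𝓔, ∀ g ∈ 𝓔, f ≠ e₁ → g ≠ e₁ → f ≠ g → f ∩ g ⊆ e₁

variable {𝓔 : Finset (Finset V)} {k m : ℕ}

/-- Double counting of the pairs `(v, f)` with `v ∈ e ∩ f`; the term `f = e` gives `#e`. -/
theorem sum_memberDegree_eq {e : Finset V} (he : e ∈ 𝓔) :
    ∑ v ∈ e, 𝓔.memberDegree v = #e + ∑ f ∈ 𝓔.erase e, #(e ∩ f) := by
  have h : ∑ v ∈ e, 𝓔.memberDegree v = ∑ f ∈ 𝓔, #(e ∩ f) := by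
    simp only [memberDegree, Finset.card_filter, ← Finset.filter_mem_eq_inter]
    exact Finset.sum_comm
  rw [h, ← Finset.add_sum_erase _ _ he, inter_self]

/-- Of the `m - 1` other edges at most one meets `e₁` in two vertices and the rest in at most one,
so the sum is at most `m`, and reaching `m` forces equality in every term. -/
theorem HasFewCycles.exists_isDominatedBy (h : 𝓔.HasFewCycles) (hm : #𝓔 = m)
    {e₁ : Finset V} (he₁ : e₁ ∈ 𝓔) (hS : m ≤ ∑ f ∈ 𝓔.erase e₁, #(e₁ ∩ f)) :
    (∃ e₂, 𝓔.IsDominatedBy e₁ e₂) ∧ ∑ f ∈ 𝓔.erase e₁, #(e₁ ∩ f) = m := by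
  have hpos : 0 < m := hm ▸ Finset.card_pos.2 ⟨_, he₁⟩
  have hex : ∃ e₂ ∈ 𝓔.erase e₁, 2 ≤ #(e₁ ∩ e₂) := by
    by_contra! hcon
    have : ∑ f ∈ 𝓔.erase e₁, #(e₁ ∩ f) ≤ ∑ f ∈ 𝓔.erase e₁, 1 :=
      Finset.sum_le_sum fun f hf => Nat.le_of_lt_succ (hcon f hf)
    rw [Finset.sum_const, card_erase_of_mem he₁, hm] at this
    simp at this
    omega
  obtain ⟨e₂, he₂', h2⟩ := hex
  obtain ⟨hne, he₂⟩ := mem_erase.1 he₂'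
  have hc2 : #(e₁ ∩ e₂) = 2 := le_antisymm (h.card_inter_le _ he₁ _ he₂ hne.symm) h2
  have hle : ∀ f ∈ (𝓔.erase e₁).erase e₂, #(e₁ ∩ f) ≤ 1 := by
    intro f hf
    simp only [mem_erase] at hf
    by_contra! hcon
    have hfe : 2 ≤ #(f ∩ e₁) := by rw [inter_comm]; exact hcon
    rcases h.pair_unique _ he₁ _ he₂ _ hf.2.2 _ he₁ hne.symm hf.2.1 h2 hfe with h' | h'
    · exact hf.2.1 h'
    · exact hf.1 h'
  have hcardE : #((𝓔.erase e₁).erase e₂) = m - 2 := by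
    rw [card_erase_of_mem he₂', card_erase_of_mem he₁, hm]; rfl
  have hm2 : 2 ≤ m := by
    rw [← hm]
    exact (Finset.card_pair hne.symm).symm.le.trans
      (Finset.card_le_card (by simp [insert_subset_iff, he₁, he₂]))
  have hsplit := Finset.add_sum_erase (𝓔.erase e₁) (fun f => #(e₁ ∩ f)) he₂'
  simp only [hc2] at hsplit
  have hsum_le := Finset.sum_le_sum hle
  have hone : ∑ f ∈ (𝓔.erase e₁).erase e₂, 1 = m - 2 := by
    rw [← Finset.card_eq_sum_ones, hcardE]
  have heq : ∑ f ∈ (𝓔.erase e₁).erase e₂, #(e₁ ∩ f) = ∑ f ∈ (𝓔.erase e₁).erase e₂, 1 := by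
    omega
  refine ⟨⟨e₂, he₁, he₂, hne, hc2, ?_, ?_⟩, by omega⟩
  · intro f hf hf1 hf2
    exact (Finset.sum_eq_sum_iff_of_le hle).1 heq f (by simp [hf, hf1, hf2])
  · have hmeet : ∀ f ∈ 𝓔, f ≠ e₁ → ∃ p, p ∈ e₁ ∧ p ∈ f := by
      intro f hf hf1
      have : 0 < #(e₁ ∩ f) := by
        by_cases hf2 : f = e₂
        · rw [hf2]; omega
        · rw [(Finset.sum_eq_sum_iff_of_le hle).1 heq f (by simp [hf, hf1, hf2])]
          exact one_pos
      obtain ⟨p, hp⟩ := Finset.card_pos.1 this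
      exact ⟨p, mem_inter.1 hp⟩
    -- Let `f` and `g` meet at `z` outside `e₁`. If they meet `e₁` in a common vertex, they form a
    -- second pair sharing two vertices; otherwise `e₁`, `f`, `g` form a triangle.
    intro f hf g hg hf1 hg1 hfg z hz
    by_contra hz1
    obtain ⟨hzf, hzg⟩ := mem_inter.1 hz
    obtain ⟨p, hp1, hpf⟩ := hmeet f hf hf1
    obtain ⟨q, hq1, hqg⟩ := hmeet g hg hg1
    have hzp : z ≠ p := fun h => hz1 (h ▸ hp1)
    have hqz : q ≠ z := fun h => hz1 (h ▸ hq1)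
    by_cases hpq : p = q
    · subst hpq
      have hfg2 : 2 ≤ #(f ∩ g) := by
        rw [← Finset.card_pair hzp]
        exact Finset.card_le_card (by simp [insert_subset_iff, *])
      rcases h.pair_unique _ hf _ hg _ he₁ _ he₂ hfg hne.symm hfg2 h2 with h' | h'
      · exact hf1 h'.symm
      · exact hg1 h'.symm
    · exact h.no_triangle _ he₁ _ he₂ hne.symm h2 _ he₁ _ hf _ hg hf1.symm hfg hg1
        p (by simp [*]) z hz q (by simp [*]) hzp.symm hqz.symm (Ne.symm hpq)

theorem sum_memberDegree_sub (hcard : ∀ e ∈ 𝓔, #e = k) {f : Finset V} (hf : f ∈ 𝓔) :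
    (∑ v ∈ f, (𝓔.memberDegree v : ℝ)) - k = ∑ v ∈ f, ((𝓔.memberDegree v : ℝ) - 1) := by
  rw [Finset.sum_sub_distrib, Finset.sum_const, hcard f hf, nsmul_eq_mul, mul_one]

theorem sum_ite_eq_const (s : Finset (Finset V)) {e : Finset V} (he : e ∈ s) (a t : ℝ) :
    ∑ f ∈ s, (if f = e then a else t) = a + ((#s : ℝ) - 1) * t := by
  have : ∀ f ∈ s, (if f = e then a else t) = t + if f = e then a - t else 0 := by
    intro f _
    split_ifs <;> ring
  rw [Finset.sum_congr rfl this, Finset.sum_add_distrib, Finset.sum_ite_eq', if_pos he]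
  simp
  ring

theorem sum_ite_eq_or_eq_const (s : Finset (Finset V)) {e f : Finset V} (he : e ∈ s) (hf : f ∈ s)
    (hne : f ≠ e) (a t : ℝ) :
    ∑ g ∈ s, (if g = e ∨ g = f then a else t) = 2 * a + ((#s : ℝ) - 2) * t := by
  have : ∀ g ∈ s, (if g = e ∨ g = f then a else t) =
      t + (if g = e then a - t else 0) + if g = f then a - t else 0 := by
    intro g _
    by_cases h1 : g = e
    · have h2 : g ≠ f := fun h => hne (h.symm.trans h1)
      simp [h1, hne.symm]
    · by_cases h2 : g = f <;> simp [h1, h2, hne]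
  rw [Finset.sum_congr rfl this, Finset.sum_add_distrib, Finset.sum_add_distrib,
    Finset.sum_ite_eq', Finset.sum_ite_eq', if_pos he, if_pos hf]
  simp
  ring

/-! ### Labels when one edge meets all the others -/

namespace IsDominatedBy

variable {e₁ e₂ : Finset V} (h : 𝓔.IsDominatedBy e₁ e₂)

include h

theorem memberDegree_of_notMem {f : Finset V} (hf : f ∈ 𝓔) {v : V} (hv : v ∈ f) (hv1 : v ∉ e₁) :
    𝓔.memberDegree v = 1 := by
  rw [memberDegree, Finset.card_eq_one]
  refine ⟨f, ?_⟩
  ext g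
  simp only [Finset.mem_filter, mem_singleton]
  constructor
  · rintro ⟨hg, hvg⟩
    by_contra hne
    exact hv1 (h.inter_subset g hg f hf (fun h' => hv1 (h' ▸ hvg)) (fun h' => hv1 (h' ▸ hv)) hne
      (mem_inter.2 ⟨hvg, hv⟩))
  · rintro rfl
    exact ⟨hf, hv⟩

theorem sum_excess_eq {f : Finset V} (hf : f ∈ 𝓔) :
    ∑ v ∈ f, ((𝓔.memberDegree v : ℝ) - 1) =
      ∑ v ∈ e₁ ∩ f, ((𝓔.memberDegree v : ℝ) - 1) := by
  symm
  refine Finset.sum_subset inter_subset_right fun v hv hv1 => ?_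
  rw [h.memberDegree_of_notMem hf hv (fun h' => hv1 (mem_inter.2 ⟨h', hv⟩))]
  simp

theorem excess_nonneg {v : V} (hv : v ∈ e₁) : 0 ≤ (𝓔.memberDegree v : ℝ) - 1 := by
  have : 1 ≤ 𝓔.memberDegree v := 𝓔.memberDegree_pos h.left_mem hv
  exact sub_nonneg.2 (by exact_mod_cast this)

theorem two_le_memberDegree {v : V} {f : Finset V} (hf : f ∈ 𝓔) (hf1 : f ≠ e₁) (hv : v ∈ e₁)
    (hvf : v ∈ f) : 2 ≤ 𝓔.memberDegree v := by
  rw [memberDegree, ← Finset.card_pair hf1]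
  exact Finset.card_le_card (by simp [insert_subset_iff, *, h.left_mem])

/-- A vertex of `e₁` outside `e₂` has degree at least two. -/
theorem hasStrictLabelling_of_two_le (hcard : ∀ e ∈ 𝓔, #e = k) (hm : 2 ≤ m)
    (hS : ∑ v ∈ e₁, ((𝓔.memberDegree v : ℝ) - 1) = m) {v₀ : V} (hv₀ : v₀ ∈ e₁) (hv₀' : v₀ ∉ e₂)
    (hd : 2 ≤ 𝓔.memberDegree v₀) : 𝓔.HasStrictLabelling k ((m : ℝ) - 1 + 2 / m) := by
  have hm' : (2 : ℝ) ≤ m := by exact_mod_cast hm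
  set c : ℝ := (𝓔.memberDegree v₀ : ℝ) - 1 with hc
  have hc1 : 1 ≤ c := by
    have : (2 : ℝ) ≤ 𝓔.memberDegree v₀ := by exact_mod_cast hd
    linarith
  have hrest : ∑ v ∈ e₁.erase v₀, ((𝓔.memberDegree v : ℝ) - 1) = m - c := by
    have := Finset.add_sum_erase e₁ (fun v => (𝓔.memberDegree v : ℝ) - 1) hv₀
    linarith
  -- The two vertices of `e₁ ∩ e₂` differ from `v₀`, and each contributes at least one to the excess
  -- `m` of `e₁`.
  have hc2 : c ≤ m - 2 := by
    have h1 : ∑ v ∈ e₁ ∩ e₂, (1 : ℝ) ≤ ∑ v ∈ e₁ ∩ e₂, ((𝓔.memberDegree v : ℝ) - 1) := by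
      refine Finset.sum_le_sum fun v hv => ?_
      have : 2 ≤ 𝓔.memberDegree v := h.two_le_memberDegree h.right_mem h.ne (mem_inter.1 hv).1
        (mem_inter.1 hv).2
      have : (2 : ℝ) ≤ 𝓔.memberDegree v := by exact_mod_cast this
      linarith
    have h2 : ∑ v ∈ e₁ ∩ e₂, ((𝓔.memberDegree v : ℝ) - 1) ≤
        ∑ v ∈ e₁.erase v₀, ((𝓔.memberDegree v : ℝ) - 1) := by
      refine Finset.sum_le_sum_of_subset_of_nonneg ?_ fun v hv _ =>
        h.excess_nonneg (mem_erase.1 hv).2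
      intro v hv
      obtain ⟨hv1, hv2⟩ := mem_inter.1 hv
      exact mem_erase.2 ⟨fun h' => hv₀' (h' ▸ hv2), hv1⟩
    rw [Finset.sum_const, h.card_inter] at h1
    simp only [nsmul_eq_mul] at h1
    push_cast at h1
    linarith
  set ε : ℝ := 2 / m with hε
  have hε0 : 0 < ε := by positivity
  set L : ℝ := m - 1 + ε with hL
  have hL0 : 0 < L := by linarith
  -- Each edge other than `e₁` at `v₀` has excess `c`, so a label `t` with `L * t = c + ε` leaves
  -- slack `ε`. The rest of the degree `1 + c` of `v₀` goes to `e₁`.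
  set t : ℝ := (c + ε) / L with ht
  have hLt : L * t = c + ε := mul_div_cancel₀ _ hL0.ne'
  have ht0 : 0 ≤ t := div_nonneg (by linarith) hL0.le
  have ht1 : t ≤ 1 := div_le_one_of_le₀ (by linarith) hL0.le
  have hA : 0 ≤ 1 + c - c * t := by nlinarith
  refine ⟨fun v f => if v = v₀ then (if f = e₁ then 1 + c - c * t else t) else 1, ?_, ?_, ?_⟩
  · intro e _ v _
    dsimp only
    split_ifs <;> first | assumption | exact zero_le_one
  · intro v
    by_cases hv : v = v₀
    · subst hv
      simp only [if_true]
      rw [sum_ite_eq_const _ (by simp [h.left_mem, hv₀])]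
      change 1 + c - c * t + ((𝓔.memberDegree v : ℝ) - 1) * t ≤ _
      rw [← hc]
      linarith
    · simp [hv, memberDegree]
  · intro e he
    rw [sum_memberDegree_sub hcard he, Finset.prod_ite_eq']
    by_cases he1 : e = e₁
    · subst he1
      rw [hS, if_pos hv₀, if_pos rfl]
      -- As `1 ≤ c ≤ m - 2`, this is at least `L + 1`, which exceeds `m`.
      have : L * (1 + c - c * t) = L + c * (m - 1 - c) := by
        calc _ = L + c * L - c * (L * t) := by ring
          _ = _ := by rw [hLt]; ring
      rw [this]
      nlinarith
    · rw [h.sum_excess_eq he]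
      by_cases hve : v₀ ∈ e
      · rw [if_pos hve, if_neg he1, hLt]
        have h1 := h.card_inter_other e he he1 (fun h' => hv₀' (h' ▸ hve))
        obtain ⟨p, hp⟩ := Finset.card_eq_one.1 h1
        have : v₀ ∈ e₁ ∩ e := mem_inter.2 ⟨hv₀, hve⟩
        rw [hp, mem_singleton] at this
        rw [hp, Finset.sum_singleton, ← this]
        linarith
      · rw [if_neg hve, mul_one]
        have h2 : ∑ v ∈ e₁ ∩ e, ((𝓔.memberDegree v : ℝ) - 1) ≤
            ∑ v ∈ e₁.erase v₀, ((𝓔.memberDegree v : ℝ) - 1) := by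
          refine Finset.sum_le_sum_of_subset_of_nonneg ?_ fun v hv _ =>
            h.excess_nonneg (mem_erase.1 hv).2
          intro v hv
          obtain ⟨hv1, hv2⟩ := mem_inter.1 hv
          exact mem_erase.2 ⟨fun h' => hve (h' ▸ hv2), hv1⟩
        linarith

/-- Both vertices of `e₁ ∩ e₂` have degree at least three. -/
theorem hasStrictLabelling_of_three_le (hcard : ∀ e ∈ 𝓔, #e = k) (hm : 2 ≤ m)
    (hS : ∑ v ∈ e₁, ((𝓔.memberDegree v : ℝ) - 1) = m) {u w : V} (huw : u ≠ w)
    (hint : e₁ ∩ e₂ = {u, w}) (hone : ∀ v ∈ e₁, v ∉ e₂ → 𝓔.memberDegree v = 1)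
    (hu : 3 ≤ 𝓔.memberDegree u) (hw : 3 ≤ 𝓔.memberDegree w) :
    𝓔.HasStrictLabelling k ((m : ℝ) - 1 + 2 / m) := by
  have hm' : (2 : ℝ) ≤ m := by exact_mod_cast hm
  have hu' : (3 : ℝ) ≤ 𝓔.memberDegree u := by exact_mod_cast hu
  have hw' : (3 : ℝ) ≤ 𝓔.memberDegree w := by exact_mod_cast hw
  have hS2 : ∑ v ∈ e₂, ((𝓔.memberDegree v : ℝ) - 1) = m := by
    rw [h.sum_excess_eq h.right_mem, ← hS]
    refine Finset.sum_subset inter_subset_left fun v hv hv1 => ?_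
    rw [hone v hv (fun h' => hv1 (mem_inter.2 ⟨hv, h'⟩))]
    simp
  have hab : (𝓔.memberDegree u : ℝ) - 1 + (𝓔.memberDegree w - 1) = m := by
    rw [← hS2, h.sum_excess_eq h.right_mem, hint, Finset.sum_pair huw]
  have humem : u ∈ e₁ ∩ e₂ := by simp [hint]
  have hwmem : w ∈ e₁ ∩ e₂ := by simp [hint]
  rw [mem_inter] at humem hwmem
  set a : ℝ := (𝓔.memberDegree u : ℝ) - 2 with ha
  set b : ℝ := (𝓔.memberDegree w : ℝ) - 2 with hb
  have ha1 : 1 ≤ a := by linarith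
  have hb1 : 1 ≤ b := by linarith
  set ε : ℝ := 2 / m with hε
  have hε0 : 0 < ε := by positivity
  set L : ℝ := m - 1 + ε with hL
  have hL0 : 0 < L := by linarith
  have hLab : L = a + b + 1 + ε := by linarith
  -- Edges other than `e₁`, `e₂` at `u` have excess `a + 1`, and `L * s` exceeds it by `ε`; likewise
  -- for `t` at `w`. What remains of the degree is split equally between `e₁` and `e₂`. The
  -- resulting label is symmetric in `a` and `b`, hence the same `A` at `u` and `w`.
  set A : ℝ := 1 + a * b / (2 * L) with hA
  have hA0 : 0 ≤ A := by positivity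
  set s : ℝ := (a + 1 + ε) / L with hs
  set t : ℝ := (b + 1 + ε) / L with ht
  have hs0 : 0 ≤ s := by positivity
  have ht0 : 0 ≤ t := by positivity
  have hLs : L * s = a + 1 + ε := mul_div_cancel₀ _ hL0.ne'
  have hLt : L * t = b + 1 + ε := mul_div_cancel₀ _ hL0.ne'
  have hAs : 2 * A + a * s = a + 2 := by
    rw [hA, hs]
    field_simp
    rw [hLab]
    ring
  have hAt : 2 * A + b * t = b + 2 := by
    rw [hA, ht]
    field_simp
    rw [hLab]
    ring
  -- Since `a * b ≥ 1`, already `L + a * b` exceeds `m`.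
  have hLA : (m : ℝ) < L * (A * A) := by
    have : L * (A * A) = L + a * b + (a * b) ^ 2 / (4 * L) := by
      rw [hA]
      field_simp
      ring
    rw [this]
    have : 0 ≤ (a * b) ^ 2 / (4 * L) := by positivity
    nlinarith
  refine ⟨fun v f => (if v = u then (if f = e₁ ∨ f = e₂ then A else s) else 1) *
    (if v = w then (if f = e₁ ∨ f = e₂ then A else t) else 1), ?_, ?_, ?_⟩
  · intro e _ v _
    dsimp only
    refine mul_nonneg ?_ ?_ <;> split_ifs <;> first | assumption | exact zero_le_one
  · intro v
    by_cases hvu : v = u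
    · subst hvu
      simp only [if_true, if_neg huw, mul_one]
      rw [sum_ite_eq_or_eq_const _ (by simp [h.left_mem, humem]) (by simp [h.right_mem, humem])
        h.ne]
      change 2 * A + ((𝓔.memberDegree v : ℝ) - 2) * s ≤ _
      rw [← ha]
      linarith
    · by_cases hvw : v = w
      · subst hvw
        simp only [if_true, if_neg hvu, one_mul]
        rw [sum_ite_eq_or_eq_const _ (by simp [h.left_mem, hwmem]) (by simp [h.right_mem, hwmem])
          h.ne]
        change 2 * A + ((𝓔.memberDegree v : ℝ) - 2) * t ≤ _
        rw [← hb]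
        linarith
      · simp [hvu, hvw, memberDegree]
  · intro e he
    rw [sum_memberDegree_sub hcard he, Finset.prod_mul_distrib, Finset.prod_ite_eq',
      Finset.prod_ite_eq']
    by_cases he1 : e = e₁
    · subst he1
      simpa [hS, humem, hwmem] using hLA
    by_cases he2 : e = e₂
    · subst he2
      simpa [hS2, humem, hwmem] using hLA
    obtain ⟨p, hp⟩ := Finset.card_eq_one.1 (h.card_inter_other e he he1 he2)
    have hpe : p ∈ e₁ ∩ e := by simp [hp]
    rw [mem_inter] at hpe
    rw [h.sum_excess_eq he, hp, Finset.sum_singleton]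
    have huniq : ∀ v ∈ e₁, v ∈ e → v = p := fun v h1 h2 => by
      have := mem_inter.2 ⟨h1, h2⟩
      rwa [hp, mem_singleton] at this
    by_cases hue : u ∈ e
    · have hup := huniq u humem.1 hue
      have hwe : w ∉ e := fun h' => huw (hup.trans (huniq w hwmem.1 h').symm)
      simp only [hue, hwe, he1, he2, or_self, if_true, if_false, mul_one]
      rw [hLs, ← hup]
      linarith
    · by_cases hwe : w ∈ e
      · have hwp := huniq w hwmem.1 hwe
        simp only [hue, hwe, he1, he2, or_self, if_true, if_false, one_mul]
        rw [hLt, ← hwp]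
        linarith
      · have hp2 : p ∉ e₂ := by
          intro h'
          have : p ∈ e₁ ∩ e₂ := mem_inter.2 ⟨hpe.1, h'⟩
          rw [hint, mem_insert, mem_singleton] at this
          rcases this with rfl | rfl
          · exact hue hpe.2
          · exact hwe hpe.2
        rw [hone p hpe.1 hp2]
        simp only [hue, hwe, if_false, mul_one]
        simpa using hL0

/-- One of the vertices of `e₁ ∩ e₂` has degree two, and the vertices of `e₁` outside `e₂` have
degree one. -/
theorem isExtremal (hcard : ∀ e ∈ 𝓔, #e = k) (hm : #𝓔 = m) (hcov : ∀ v, ∃ e ∈ 𝓔, v ∈ e)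
    {u w : V} (huw : u ≠ w)
    (hint : e₁ ∩ e₂ = {u, w}) (hone : ∀ v ∈ e₁, v ∉ e₂ → 𝓔.memberDegree v = 1)
    (hw : 𝓔.memberDegree w = 2) : 𝓔.IsExtremal k m := by
  refine ⟨hcard, hm, hcov, u, w, huw, e₁, h.left_mem, e₂, h.right_mem, h.ne.symm, ?_⟩
  have humem : u ∈ e₁ ∩ e₂ := by simp [hint]
  have hwmem : w ∈ e₁ ∩ e₂ := by simp [hint]
  rw [mem_inter] at humem hwmem
  -- The degree two of `w` is used up by `e₁` and `e₂`.
  have hwf : ∀ f ∈ 𝓔, f ≠ e₁ → f ≠ e₂ → w ∉ f := by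
    intro f hf hf1 hf2 hwf
    have : #({f, e₁, e₂} : Finset (Finset V)) ≤ 𝓔.memberDegree w :=
      Finset.card_le_card (by
        simp [insert_subset_iff, hf, hwf, hwmem, h.left_mem, h.right_mem])
    rw [hw, Finset.card_eq_three.2 ⟨f, e₁, e₂, hf1, hf2, h.ne.symm, rfl⟩] at this
    omega
  -- The vertex where `f` meets `e₁` has degree at least two, hence lies in `e₂` and is `u` or `w`;
  -- `w` is excluded.
  have hinter : ∀ f ∈ 𝓔, f ≠ e₁ → f ≠ e₂ → e₁ ∩ f = {u} := by
    intro f hf hf1 hf2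
    obtain ⟨p, hp⟩ := Finset.card_eq_one.1 (h.card_inter_other f hf hf1 hf2)
    have hpe : p ∈ e₁ ∩ f := by simp [hp]
    rw [mem_inter] at hpe
    have hp2 : p ∈ e₂ := by
      by_contra hp2
      have := h.two_le_memberDegree hf hf1 hpe.1 hpe.2
      rw [hone p hpe.1 hp2] at this
      omega
    have : p ∈ e₁ ∩ e₂ := mem_inter.2 ⟨hpe.1, hp2⟩
    rw [hint, mem_insert, mem_singleton] at this
    rcases this with rfl | rfl
    · exact hp
    · exact absurd hpe.2 (hwf f hf hf1 hf2)
  have humem' : ∀ g ∈ 𝓔, u ∈ g := by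
    intro g hg
    by_cases hg1 : g = e₁
    · rw [hg1]; exact humem.1
    by_cases hg2 : g = e₂
    · rw [hg2]; exact humem.2
    have : u ∈ e₁ ∩ g := by rw [hinter g hg hg1 hg2]; exact mem_singleton_self u
    exact (mem_inter.1 this).2
  refine ⟨humem', fun e he => ⟨fun hwe => ?_, ?_⟩, fun e he f hf v hve hvf hvu hvw => ?_⟩
  · by_contra! hne
    exact hwf e he hne.1 hne.2 hwe
  · rintro (rfl | rfl)
    · exact hwmem.1
    · exact hwmem.2
  · by_contra hne
    have h2 : 2 ≤ 𝓔.memberDegree v := by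
      rw [memberDegree, ← Finset.card_pair hne]
      exact Finset.card_le_card (by simp [insert_subset_iff, *])
    by_cases hv1 : v ∈ e₁
    · have hv2 : v ∉ e₂ := fun h' => by
        have : v ∈ e₁ ∩ e₂ := mem_inter.2 ⟨hv1, h'⟩
        simp [hint, hvu, hvw] at this
      rw [hone v hv1 hv2] at h2
      omega
    · rw [h.memberDegree_of_notMem he hve hv1] at h2
      omega

end IsDominatedBy

/-- If every excess is below `m`, constant labels `1` are strict because `m - 1 < L`. Otherwise an
edge of excess `m` dominates, and the degrees of its vertices decide the case. -/
theorem HasFewCycles.hasStrictLabelling_or_isExtremal (h : 𝓔.HasFewCycles)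
    (hcard : ∀ e ∈ 𝓔, #e = k) (hm : #𝓔 = m) (hm2 : 2 ≤ m) (hcov : ∀ v, ∃ e ∈ 𝓔, v ∈ e) :
    𝓔.HasStrictLabelling k ((m : ℝ) - 1 + 2 / m) ∨ 𝓔.IsExtremal k m := by
  by_cases hA : ∀ e ∈ 𝓔, ∑ f ∈ 𝓔.erase e, #(e ∩ f) < m
  · left
    refine ⟨fun _ _ => 1, fun _ _ _ _ => zero_le_one, fun v => by simp [memberDegree], ?_⟩
    intro e he
    have h1 := hA e he
    have h2 := sum_memberDegree_eq he
    rw [hcard e he] at h2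
    have h3 : ∑ v ∈ e, 𝓔.memberDegree v + 1 ≤ k + m := by omega
    have h4 : (∑ v ∈ e, (𝓔.memberDegree v : ℝ)) + 1 ≤ k + m := by exact_mod_cast h3
    have : (0 : ℝ) < 2 / m := by positivity
    simp only [Finset.prod_const_one, mul_one]
    linarith
  · push Not at hA
    obtain ⟨e₁, he₁, hS⟩ := hA
    obtain ⟨⟨e₂, hdom⟩, hS⟩ := h.exists_isDominatedBy hm he₁ hS
    have hS' : ∑ v ∈ e₁, ((𝓔.memberDegree v : ℝ) - 1) = m := by
      rw [← sum_memberDegree_sub hcard he₁]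
      have := sum_memberDegree_eq he₁
      rw [hcard e₁ he₁, hS] at this
      have : (∑ v ∈ e₁, (𝓔.memberDegree v : ℝ)) = k + m := by exact_mod_cast this
      linarith
    by_cases hone : ∃ v ∈ e₁, v ∉ e₂ ∧ 2 ≤ 𝓔.memberDegree v
    · obtain ⟨v, hv1, hv2, hv⟩ := hone
      exact Or.inl (hdom.hasStrictLabelling_of_two_le hcard hm2 hS' hv1 hv2 hv)
    have hone' : ∀ v ∈ e₁, v ∉ e₂ → 𝓔.memberDegree v = 1 := by
      intro v hv1 hv2
      by_contra hne
      have := 𝓔.memberDegree_pos he₁ hv1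
      exact hone ⟨v, hv1, hv2, by omega⟩
    obtain ⟨u, w, huw, hint⟩ := Finset.card_eq_two.1 hdom.card_inter
    have hdeg : ∀ v ∈ e₁ ∩ e₂, 2 ≤ 𝓔.memberDegree v := fun v hv =>
      hdom.two_le_memberDegree hdom.right_mem hdom.ne (mem_inter.1 hv).1 (mem_inter.1 hv).2
    have hu := hdeg u (by simp [hint])
    have hw := hdeg w (by simp [hint])
    by_cases hw2 : 𝓔.memberDegree w = 2
    · exact Or.inr (hdom.isExtremal hcard hm hcov huw hint hone' hw2)
    by_cases hu2 : 𝓔.memberDegree u = 2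
    · exact Or.inr (hdom.isExtremal hcard hm hcov huw.symm (hint.trans (pair_comm u w)) hone' hu2)
    exact Or.inl (hdom.hasStrictLabelling_of_three_le hcard hm2 hS' huw hint hone'
      (by omega) (by omega))

end Finset

/-! ### Consistent edge numbers for the extremal configuration -/

namespace Finset

variable {V : Type*} [DecidableEq V] {𝓔 : Finset (Finset V)} {k m : ℕ}

/-- The numbers attached to the edges of the extremal hypergraph from which its Perron vector and
an optimal labelling are obtained. -/
theorem IsExtremal.exists_consistent (h : 𝓔.IsExtremal k m) (hk : 3 ≤ k) (hm : 2 ≤ m) :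
    ∃ q : Finset V → ℝ, (∀ e ∈ 𝓔, 0 < q e) ∧
      ∀ e ∈ 𝓔, ((∑ v ∈ e, (𝓔.memberDegree v : ℝ)) - k) * ∏ v ∈ e, ∑ f ∈ 𝓔 with v ∈ f, q f =
        ((m : ℝ) - 1 + 2 / m) * q e ^ k * ∏ v ∈ e, (𝓔.memberDegree v : ℝ) := by
  obtain ⟨hcard, hm𝓔, -, u, w, huw, e₁, he₁, e₂, he₂, hne, hu, hw, huniq⟩ := h
  have hm' : (2 : ℝ) ≤ m := by exact_mod_cast hm
  set L : ℝ := (m : ℝ) - 1 + 2 / m with hL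
  have hL0 : 0 < L := by
    have : (0 : ℝ) < 2 / m := by positivity
    linarith
  have hmL : m * L = m ^ 2 - m + 2 := by
    rw [hL]
    field_simp
  -- Normalise the sum at `u` to `1`. The condition on `e₁` and `e₂` then forces the value `1 / L`,
  -- and the condition on a pendant edge forces `p`. The normalisation `2 / L + (m - 2) * p = 1`
  -- holds for `L = m - 1 + 2 / m`.
  set p : ℝ := (m - 1) / (m * L) with hp
  set q : Finset V → ℝ := fun e => if e = e₁ ∨ e = e₂ then 1 / L else p with hq
  have hp0 : 0 < p := div_pos (by linarith) (by positivity)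
  have hfilu : {f ∈ 𝓔 | u ∈ f} = 𝓔 := Finset.filter_true_of_mem hu
  have hfilw : {f ∈ 𝓔 | w ∈ f} = {e₁, e₂} := by
    ext f
    simp only [Finset.mem_filter, mem_insert, mem_singleton]
    refine ⟨fun hf => (hw f hf.1).1 hf.2, fun hf => ?_⟩
    have : f ∈ 𝓔 := by rcases hf with rfl | rfl <;> assumption
    exact ⟨this, (hw f this).2 hf⟩
  have hfil : ∀ e ∈ 𝓔, ∀ v ∈ e, v ≠ u → v ≠ w → {f ∈ 𝓔 | v ∈ f} = {e} := by
    intro e he v hv hvu hvw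
    ext f
    simp only [Finset.mem_filter, mem_singleton]
    refine ⟨fun hf => (huniq e he f hf.1 v hv hf.2 hvu hvw).symm, ?_⟩
    rintro rfl
    exact ⟨he, hv⟩
  have hdu : 𝓔.memberDegree u = m := by rw [memberDegree, hfilu, hm𝓔]
  have hdw : 𝓔.memberDegree w = 2 := by rw [memberDegree, hfilw, Finset.card_pair hne]
  have hd : ∀ e ∈ 𝓔, ∀ v ∈ e, v ≠ u → v ≠ w → 𝓔.memberDegree v = 1 := fun e he v hv h1 h2 => by
    rw [memberDegree, hfil e he v hv h1 h2, card_singleton]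
  have hyu : ∑ f ∈ 𝓔 with u ∈ f, q f = 1 := by
    rw [hfilu, sum_ite_eq_or_eq_const _ he₁ he₂ hne.symm, hm𝓔, hp]
    field_simp
    linarith
  have hyw : ∑ f ∈ 𝓔 with w ∈ f, q f = 2 / L := by
    rw [hfilw, Finset.sum_pair hne]
    simp only [hq, true_or, or_true, if_true]
    ring
  have hy : ∀ e ∈ 𝓔, ∀ v ∈ e, v ≠ u → v ≠ w → ∑ f ∈ 𝓔 with v ∈ f, q f = q e :=
    fun e he v hv h1 h2 => by rw [hfil e he v hv h1 h2, Finset.sum_singleton]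
  refine ⟨q, fun e _ => ?_, fun e he => ?_⟩
  · simp only [hq]
    split_ifs
    · positivity
    · exact hp0
  rw [sum_memberDegree_sub hcard he, ← Finset.add_sum_erase e _ (hu e he),
    ← Finset.mul_prod_erase e _ (hu e he), ← Finset.mul_prod_erase e _ (hu e he), hdu, hyu]
  by_cases hwe : w ∈ e
  · have hqe : q e = 1 / L := if_pos ((hw e he).1 hwe)
    have hwe' : w ∈ e.erase u := mem_erase.2 ⟨huw.symm, hwe⟩
    have hmem : ∀ v ∈ (e.erase u).erase w, v ∈ e ∧ v ≠ u ∧ v ≠ w := fun v hv => by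
      simp only [mem_erase] at hv
      exact ⟨hv.2.2, hv.2.1, hv.1⟩
    have hcarde : #((e.erase u).erase w) = k - 2 := by
      rw [card_erase_of_mem hwe', card_erase_of_mem (hu e he), hcard e he]
      rfl
    have hsum0 : ∑ v ∈ (e.erase u).erase w, ((𝓔.memberDegree v : ℝ) - 1) = 0 :=
      Finset.sum_eq_zero fun v hv => by
        obtain ⟨h1, h2, h3⟩ := hmem v hv
        rw [hd e he v h1 h2 h3, Nat.cast_one, sub_self]
    have hprod1 : ∏ v ∈ (e.erase u).erase w, (𝓔.memberDegree v : ℝ) = 1 :=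
      Finset.prod_eq_one fun v hv => by
        obtain ⟨h1, h2, h3⟩ := hmem v hv
        rw [hd e he v h1 h2 h3, Nat.cast_one]
    have hprody : ∏ v ∈ (e.erase u).erase w, ∑ f ∈ 𝓔 with v ∈ f, q f = q e ^ #((e.erase u).erase w) := by
      rw [← Finset.prod_const]
      exact Finset.prod_congr rfl fun v hv => by
        obtain ⟨h1, h2, h3⟩ := hmem v hv
        exact hy e he v h1 h2 h3
    rw [← Finset.add_sum_erase _ _ hwe', ← Finset.mul_prod_erase _ _ hwe',
      ← Finset.mul_prod_erase _ _ hwe', hdw, hyw, hsum0, hprod1, hprody, hcarde, hqe]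
    obtain ⟨n, rfl⟩ : ∃ n, k = n + 2 := ⟨k - 2, by omega⟩
    rw [Nat.add_sub_cancel, pow_add]
    push_cast
    field_simp
    ring
  · have hqe : q e = p := if_neg fun h' => hwe ((hw e he).2 h')
    have hmem : ∀ v ∈ e.erase u, v ∈ e ∧ v ≠ u ∧ v ≠ w := fun v hv => by
      simp only [mem_erase] at hv
      exact ⟨hv.2, hv.1, fun h' => hwe (h' ▸ hv.2)⟩
    have hcarde : #(e.erase u) = k - 1 := by
      rw [card_erase_of_mem (hu e he), hcard e he]
    have hsum0 : ∑ v ∈ e.erase u, ((𝓔.memberDegree v : ℝ) - 1) = 0 :=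
      Finset.sum_eq_zero fun v hv => by
        obtain ⟨h1, h2, h3⟩ := hmem v hv
        rw [hd e he v h1 h2 h3, Nat.cast_one, sub_self]
    have hprod1 : ∏ v ∈ e.erase u, (𝓔.memberDegree v : ℝ) = 1 :=
      Finset.prod_eq_one fun v hv => by
        obtain ⟨h1, h2, h3⟩ := hmem v hv
        rw [hd e he v h1 h2 h3, Nat.cast_one]
    have hprody : ∏ v ∈ e.erase u, ∑ f ∈ 𝓔 with v ∈ f, q f = q e ^ #(e.erase u) := by
      rw [← Finset.prod_const]
      exact Finset.prod_congr rfl fun v hv => by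
        obtain ⟨h1, h2, h3⟩ := hmem v hv
        exact hy e he v h1 h2 h3
    rw [hsum0, hprod1, hprody, hcarde, hqe]
    obtain ⟨n, rfl⟩ : ∃ n, k = n + 1 := ⟨k - 1, by omega⟩
    have hLp : L * p * m = m - 1 := by
      rw [hp]
      field_simp
    rw [Nat.add_sub_cancel, pow_succ]
    linear_combination -(p ^ n) * hLp

/-- A consistent system of numbers gives a labelling of the edges. -/
theorem le_mul_prod_label (hcard : ∀ e ∈ 𝓔, #e = k) {L : ℝ} {q : Finset V → ℝ}
    (hq : ∀ e ∈ 𝓔, 0 < q e) {e : Finset V} (he : e ∈ 𝓔)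
    (h : ((∑ v ∈ e, (𝓔.memberDegree v : ℝ)) - k) * ∏ v ∈ e, ∑ f ∈ 𝓔 with v ∈ f, q f =
        L * q e ^ k * ∏ v ∈ e, (𝓔.memberDegree v : ℝ)) :
    (∑ v ∈ e, (𝓔.memberDegree v : ℝ)) - k ≤
      L * ∏ v ∈ e, 𝓔.memberDegree v * q e / ∑ f ∈ 𝓔 with v ∈ f, q f := by
  have hpos : 0 < ∏ v ∈ e, ∑ f ∈ 𝓔 with v ∈ f, q f :=
    Finset.prod_pos fun v hv =>
      Finset.sum_pos (fun f hf => hq f (Finset.mem_filter.1 hf).1) ⟨e, by simp [he, hv]⟩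
  rw [Finset.prod_div_distrib, Finset.prod_mul_distrib, Finset.prod_const, hcard e he,
    ← mul_div_assoc, le_div_iff₀ hpos, h]
  exact le_of_eq (by ring)

end Finset

/-! ### Consequences for the ABC spectral radius -/

namespace Hypergraph

variable {α : Type*} (G : Hypergraph α) [Fintype G.vertexSet] [DecidableEq G.vertexSet] {k m : ℕ}

theorem abcSpectralRadius_le_of_labelling (hk : 0 < k) (hunif : G.IsUniform k) {L : ℝ}
    (hL : 0 ≤ L) (b : G.vertexSet → Finset G.vertexSet → ℝ)
    (hb : ∀ e ∈ G.finsetEdges, ∀ v ∈ e, 0 ≤ b v e)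
    (hsum : ∀ v, ∑ e ∈ G.finsetEdges with v ∈ e, b v e ≤ G.finsetEdges.memberDegree v)
    (hprod : ∀ e ∈ G.finsetEdges,
      (∑ v ∈ e, (G.finsetEdges.memberDegree v : ℝ)) - k ≤ L * ∏ v ∈ e, b v e) :
    G.abcSpectralRadius k ≤ L ^ ((1 : ℝ) / k) := by
  refine Real.sSup_le ?_ (Real.rpow_nonneg hL _)
  rintro r ⟨z, ⟨x, hx, hz⟩, rfl⟩
  refine norm_le_of_labelling G.finsetEdges hk (fun e he => G.card_of_mem_finsetEdges hunif he)
    hL b hb hsum hprod hx fun i => ?_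
  rw [← hz i, G.abcTensor_apply hk hunif]

theorem abcSpectralRadius_lt_of_hasStrictLabelling (hk : 0 < k) (hunif : G.IsUniform k) {L : ℝ}
    (hL : 0 < L) (h : G.finsetEdges.HasStrictLabelling k L) :
    G.abcSpectralRadius k < L ^ ((1 : ℝ) / k) := by
  obtain ⟨b, hb, hsum, hprod⟩ := h
  obtain ⟨L', hL'0, hL'L, hL'⟩ := exists_lt_forall_le_mul G.finsetEdges _ _ hL
    (fun e he => by
      have := G.finsetEdges.le_sum_memberDegree he
      rw [G.card_of_mem_finsetEdges hunif he] at this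
      exact sub_nonneg.2 this) hprod
  refine (G.abcSpectralRadius_le_of_labelling hk hunif hL'0 b hb hsum hL').trans_lt ?_
  exact Real.rpow_lt_rpow hL'0 hL'L (by positivity)

/-- The labels `d_v * q e / ∑ f ∋ v, q f` give the upper bound; the eigenvector built from `q`
attains it. -/
theorem abcSpectralRadius_of_isExtremal (hk : 3 ≤ k) (hm : 2 ≤ m) (hunif : G.IsUniform k)
    (h : G.finsetEdges.IsExtremal k m) :
    G.abcSpectralRadius k = ((m : ℝ) - 1 + 2 / m) ^ ((1 : ℝ) / k) := by
  have hm' : (2 : ℝ) ≤ m := by exact_mod_cast hm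
  have hL : 0 ≤ (m : ℝ) - 1 + 2 / m := by
    have : (0 : ℝ) < 2 / m := by positivity
    linarith
  obtain ⟨q, hq, hqe⟩ := h.exists_consistent hk hm
  have hcard := h.1
  refine le_antisymm ?_ ?_
  · refine G.abcSpectralRadius_le_of_labelling (by omega) hunif hL
      (fun v e => G.finsetEdges.memberDegree v * q e / ∑ f ∈ G.finsetEdges with v ∈ f, q f)
      (fun e he v hv => ?_) (fun v => ?_) fun e he => le_mul_prod_label hcard hq he (hqe e he)
    · exact div_nonneg (mul_nonneg (Nat.cast_nonneg _) (hq e he).le)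
        (Finset.sum_nonneg fun f hf => (hq f (Finset.mem_filter.1 hf).1).le)
    · rw [← Finset.sum_div, ← Finset.mul_sum, mul_div_assoc]
      exact mul_le_of_le_one_right (Nat.cast_nonneg _) (div_self_le_one _)
  · have hne : G.finsetEdges.Nonempty := by
      rw [← Finset.card_pos, h.2.1]
      omega
    obtain ⟨x, hx, hev⟩ := G.finsetEdges.exists_eigenvector (by omega) hcard hL q hq hne hqe
    refine le_csSup (RealTensor.bddAbove_eigenvalues _)
      ⟨((((m : ℝ) - 1 + 2 / m) ^ ((1 : ℝ) / k) : ℝ) : ℂ), ⟨x, hx, fun i => ?_⟩, ?_⟩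
    · rw [G.abcTensor_apply (by omega) hunif]
      exact hev i
    · rw [Complex.norm_real, Real.norm_eq_abs, abs_of_nonneg (Real.rpow_nonneg hL _)]

end Hypergraph

/-! ### Consequences of having exactly one cycle -/

namespace Hypergraph

section Cycles

variable {α : Type*} {G : Hypergraph α}

theorem isCycle_pair {e f : Set α} (he : e ∈ G.edgeSet) (hf : f ∈ G.edgeSet) (hef : e ≠ f)
    {p q : α} (hpq : p ≠ q) (hpe : p ∈ e) (hpf : p ∈ f) (hqe : q ∈ e) (hqf : q ∈ f) :
    G.IsCycle ({p, q}, {e, f}) := by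
  -- `ZMod 2` unfolds to `Fin 2`. Any two indices are equal or cyclically consecutive, so the
  -- disjointness condition is vacuous; the same holds for length three.
  refine ⟨2, le_rfl, (![p, q] : Fin 2 → α), (![e, f] : Fin 2 → Set α), ?_, ?_, ?_, ?_, ?_, ?_⟩
  · intro i j h
    fin_cases i <;> fin_cases j <;> first | rfl | simp_all
  · intro i j h
    fin_cases i <;> fin_cases j <;> first | rfl | simp_all
  · intro i
    fin_cases i <;> simpa
  · intro i
    fin_cases i
    · exact ⟨hpe, hqe⟩
    · exact ⟨hqf, hpf⟩
  · intro i j h1 h2 h3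
    fin_cases i <;> fin_cases j
    · exact absurd rfl h1
    · exact absurd rfl h2
    · exact absurd rfl h2
    · exact absurd rfl h1
  · refine Prod.ext ?_ ?_
    · exact (by ext; simp; tauto : ({p, q} : Set α) = Set.range ![p, q])
    · exact (by ext; simp; tauto : ({e, f} : Set (Set α)) = Set.range ![e, f])

theorem isCycle_triple {a b c : Set α} (ha : a ∈ G.edgeSet) (hb : b ∈ G.edgeSet)
    (hc : c ∈ G.edgeSet) (hab : a ≠ b) (hbc : b ≠ c) (hca : c ≠ a) {p q r : α} (hpq : p ≠ q)
    (hqr : q ≠ r) (hrp : r ≠ p) (hpa : p ∈ a) (hpb : p ∈ b) (hqb : q ∈ b) (hqc : q ∈ c)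
    (hrc : r ∈ c) (hra : r ∈ a) : G.IsCycle ({r, p, q}, {a, b, c}) := by
  refine ⟨3, by norm_num, (![r, p, q] : Fin 3 → α), (![a, b, c] : Fin 3 → Set α),
    ?_, ?_, ?_, ?_, ?_, ?_⟩
  · intro i j h
    fin_cases i <;> fin_cases j <;> first | rfl | simp_all
  · intro i j h
    fin_cases i <;> fin_cases j <;> first | rfl | simp_all
  · intro i
    fin_cases i <;> simpa
  · intro i
    fin_cases i
    · exact ⟨hra, hpa⟩
    · exact ⟨hpb, hqb⟩
    · exact ⟨hqc, hrc⟩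
  · intro i j h1 h2 h3
    fin_cases i <;> fin_cases j <;>
      first | exact absurd rfl h1 | exact absurd rfl h2 | exact absurd rfl h3
  · refine Prod.ext ?_ ?_
    · exact (by ext; simp; tauto : ({r, p, q} : Set α) = Set.range ![r, p, q])
    · exact (by ext; simp; tauto : ({a, b, c} : Set (Set α)) = Set.range ![a, b, c])

theorem IsUnicyclic.eq (h : G.IsUnicyclic) {C D : Set α × Set (Set α)} (hC : G.IsCycle C)
    (hD : G.IsCycle D) : C = D :=
  h.2.unique hC hD

variable [Fintype G.vertexSet] [DecidableEq G.vertexSet]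

/-- Each violation produces two different cycles. Three common vertices give 2-cycles with different
vertex sets, two pairs of edges give 2-cycles with different edge sets, and a triangle has three
edges where a 2-cycle has two. -/
theorem IsUnicyclic.hasFewCycles (h : G.IsUnicyclic) : G.finsetEdges.HasFewCycles := by
  set ι : Finset G.vertexSet → Set α := fun s => Subtype.val '' (s : Set G.vertexSet) with hι
  have hinj : Function.Injective ι := G.image_val_injective
  have hE : ∀ {s}, s ∈ G.finsetEdges → ι s ∈ G.edgeSet := fun hs => G.mem_finsetEdges.1 hs
  have hm : ∀ {v : G.vertexSet} {s : Finset G.vertexSet}, v ∈ s → (v : α) ∈ ι s :=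
    fun {v s} hv => ⟨v, hv, rfl⟩
  have hne : ∀ {v w : G.vertexSet}, v ≠ w → (v : α) ≠ w := fun h' => Subtype.coe_ne_coe.2 h'
  have hpair : ∀ {e f}, e ∈ G.finsetEdges → f ∈ G.finsetEdges → e ≠ f → ∀ {p q}, p ≠ q →
      p ∈ e ∩ f → q ∈ e ∩ f → G.IsCycle ({(p : α), (q : α)}, {ι e, ι f}) := by
    intro e f he hf hef p q hpq hp hq
    rw [mem_inter] at hp hq
    exact isCycle_pair (hE he) (hE hf) (hinj.ne hef) (hne hpq) (hm hp.1) (hm hp.2) (hm hq.1)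
      (hm hq.2)
  refine ⟨fun e he f hf hef => ?_, ?_, ?_⟩
  · by_contra! hcon
    obtain ⟨p, hp, q, hq, r, hr, hpq, hpr, hqr⟩ := Finset.two_lt_card.1 hcon
    have heq := congrArg Prod.fst (h.eq (hpair he hf hef hpq hp hq) (hpair he hf hef hpr hp hr))
    have : (q : α) ∈ ({(p : α), (r : α)} : Set α) := by
      rw [← show ({(p : α), (q : α)} : Set α) = {(p : α), (r : α)} from heq]
      simp
    rcases this with h' | h'
    · exact hne hpq h'.symm
    · exact hne hqr h'
  · intro e he f hf e' he' f' hf' hef hef' h2 h2'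
    obtain ⟨p, hp, q, hq, hpq⟩ := Finset.one_lt_card.1 h2
    obtain ⟨p', hp', q', hq', hpq'⟩ := Finset.one_lt_card.1 h2'
    have heq := congrArg Prod.snd
      (h.eq (hpair he hf hef hpq hp hq) (hpair he' hf' hef' hpq' hp' hq'))
    have : ι e' ∈ ({ι e, ι f} : Set (Set α)) := by
      rw [show ({ι e, ι f} : Set (Set α)) = {ι e', ι f'} from heq]
      simp
    exact this.imp (fun h' => hinj h') fun h' => hinj h'
  · intro e he f hf hef h2 a ha b hb c hc hab hbc hca p hp q hq r hr hpq hqr hrp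
    obtain ⟨p', hp', q', hq', hpq'⟩ := Finset.one_lt_card.1 h2
    rw [mem_inter] at hp hq hr
    have hcyc := isCycle_triple (hE ha) (hE hb) (hE hc) (hinj.ne hab) (hinj.ne hbc) (hinj.ne hca)
      (hne hpq) (hne hqr) (hne hrp) (hm hp.1) (hm hp.2) (hm hq.1) (hm hq.2) (hm hr.1) (hm hr.2)
    have heq : ({ι e, ι f} : Set (Set α)) = {ι a, ι b, ι c} :=
      congrArg Prod.snd (h.eq (hpair he hf hef hpq' hp' hq') hcyc)
    have key : ∀ s, ι s ∈ ({ι a, ι b, ι c} : Set (Set α)) → s = e ∨ s = f := by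
      intro s hs
      rw [← heq] at hs
      exact hs.imp (fun h' => hinj h') fun h' => hinj h'
    have h1 := key a (by simp)
    have h2 := key b (by simp)
    have h3 := key c (by simp)
    -- Three distinct edges cannot all lie in `{e, f}`.
    grind

omit [DecidableEq G.vertexSet] in
-- Join `v` to a vertex of some edge: either the chain is trivial, or its first step lies in an edge
-- through `v`.
theorem IsConnected.exists_finsetEdges_mem (h : G.IsConnected) {k : ℕ} (hk : 0 < k)
    (hunif : G.IsUniform k) (hne : G.finsetEdges.Nonempty) (v : G.vertexSet) :
    ∃ e ∈ G.finsetEdges, v ∈ e := by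
  obtain ⟨e, he⟩ := hne
  obtain ⟨w, hw⟩ : e.Nonempty := by
    rw [← Finset.card_pos, G.card_of_mem_finsetEdges hunif he]
    exact hk
  rcases (h.2 v v.2 w w.2).cases_head with hvw | ⟨b, ⟨f, hf, hvf, -⟩, -⟩
  · exact ⟨e, he, (Subtype.ext hvw : v = w) ▸ hw⟩
  · obtain ⟨s, hs, rfl⟩ := G.exists_finsetEdges hf
    obtain ⟨v', hv', hvv⟩ := hvf
    exact ⟨s, hs, (Subtype.ext hvv : v' = v) ▸ hv'⟩

end Cycles

end Hypergraph

/-! ### Uniqueness of the extremal configuration -/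

namespace Finset

variable {V W : Type*} {𝓔 : Finset (Finset V)} {𝓕 : Finset (Finset W)} {k m : ℕ}

theorem IsExtremal.map_equiv (h : 𝓔.IsExtremal k m) (σ : V ≃ W)
    (hσ : ∀ s, s ∈ 𝓔 ↔ s.map σ.toEmbedding ∈ 𝓕) : 𝓕.IsExtremal k m := by
  obtain ⟨hcard, hm, hcov, u, w, huw, e₁, he₁, e₂, he₂, hne, hu, hw, huniq⟩ := h
  have hF : 𝓕 = 𝓔.map (Finset.mapEmbedding σ.toEmbedding).toEmbedding := by
    ext t
    simp only [Finset.mem_map]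
    constructor
    · intro ht
      refine ⟨t.map σ.symm.toEmbedding, ?_, ?_⟩
      · rw [hσ, Finset.map_map]
        simpa using ht
      · simp [Finset.mapEmbedding_apply, Finset.map_map]
    · rintro ⟨s, hs, rfl⟩
      exact (hσ s).1 hs
  have hmem : ∀ e ∈ 𝓕, ∃ s ∈ 𝓔, s.map σ.toEmbedding = e := by
    intro e he
    rw [hF, Finset.mem_map] at he
    exact he
  refine ⟨?_, by rw [hF, Finset.card_map, hm], ?_, σ u, σ w, σ.injective.ne huw,
    e₁.map σ.toEmbedding, (hσ _).1 he₁, e₂.map σ.toEmbedding, (hσ _).1 he₂,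
    (Finset.map_injective _).ne hne, ?_, ?_, ?_⟩
  · intro e he
    obtain ⟨s, hs, rfl⟩ := hmem e he
    rw [Finset.card_map, hcard s hs]
  · intro v
    obtain ⟨e, he, hv⟩ := hcov (σ.symm v)
    exact ⟨e.map σ.toEmbedding, (hσ _).1 he, by simpa [Finset.mem_map_equiv] using hv⟩
  · intro e he
    obtain ⟨s, hs, rfl⟩ := hmem e he
    simpa using hu s hs
  · intro e he
    obtain ⟨s, hs, rfl⟩ := hmem e he
    simpa using hw s hs
  · intro e he f hf v hve hvf hvu hvw
    obtain ⟨s, hs, rfl⟩ := hmem e he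
    obtain ⟨t, ht, rfl⟩ := hmem f hf
    rw [Finset.mem_map_equiv] at hve hvf
    rw [huniq s hs t ht _ hve hvf (fun h => hvu (by simp [← h])) (fun h => hvw (by simp [← h]))]

/-- Whether a vertex of a given colour lies in the `i`-th edge of the extremal hypergraph. The
colours stand for `u`, for `w` and for the remaining vertices of each edge. -/
def ExtremalIncidence {n : ℕ} (i : Bool ⊕ Fin n) : Option (Option (Bool ⊕ Fin n)) → Prop
  | none => True
  | some none => i.isLeft
  | some (some j) => j = i

/-- The number of vertices of a given colour in the extremal hypergraph. -/
def extremalColourCard (k : ℕ) {n : ℕ} : Option (Option (Bool ⊕ Fin n)) → ℕ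
  | none => 1
  | some none => 1
  | some (some (Sum.inl _)) => k - 2
  | some (some (Sum.inr _)) => k - 1

/-- Every vertex other than `u` and `w` lies in exactly one edge, so its colour records all its
incidences. The colour classes have sizes depending only on `k` and the type of edge, hence any
colour-preserving bijection between two such families is an isomorphism. -/
theorem IsExtremal.exists_colouring [Fintype V] [DecidableEq V] (h : 𝓔.IsExtremal k m) :
    ∃ (ε : Bool ⊕ Fin (m - 2) → Finset V) (κ : V → Option (Option (Bool ⊕ Fin (m - 2)))),
      (∀ s, s ∈ 𝓔 ↔ ∃ i, ε i = s) ∧ (∀ i v, v ∈ ε i ↔ ExtremalIncidence i (κ v)) ∧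
      ∀ c, #{v | κ v = c} = extremalColourCard k c := by
  obtain ⟨hcard, hm, hcov, u, w, huw, e₁, he₁, e₂, he₂, hne, hu, hw, huniq⟩ := h
  have hrest : #((𝓔.erase e₁).erase e₂) = m - 2 := by
    rw [card_erase_of_mem (mem_erase.2 ⟨hne.symm, he₂⟩), card_erase_of_mem he₁, hm]
    rfl
  set r := (Finset.equivFinOfCardEq hrest).symm with hr
  set ε : Bool ⊕ Fin (m - 2) → Finset V :=
    Sum.elim (fun b => if b then e₁ else e₂) (fun j => (r j : Finset V)) with hε
  have hr1 : ∀ j, (r j : Finset V) ≠ e₁ := fun j => (mem_erase.1 (mem_erase.1 (r j).2).2).1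
  have hr2 : ∀ j, (r j : Finset V) ≠ e₂ := fun j => (mem_erase.1 (r j).2).1
  have hr𝓔 : ∀ j, (r j : Finset V) ∈ 𝓔 := fun j => (mem_erase.1 (mem_erase.1 (r j).2).2).2
  have hmem : ∀ i, ε i ∈ 𝓔 := by
    rintro (b | j)
    · cases b
      · exact he₂
      · exact he₁
    · exact hr𝓔 j
  have hinj : Function.Injective ε := by
    rintro (b | j) (b' | j') hij
    · cases b <;> cases b' <;> simp [hε, hne, hne.symm] at hij ⊢
    · cases b
      · exact absurd hij.symm (hr2 j')
      · exact absurd hij.symm (hr1 j')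
    · cases b'
      · exact absurd hij (hr2 j)
      · exact absurd hij (hr1 j)
    · exact congrArg Sum.inr (r.injective (Subtype.ext hij))
  have hsurj : ∀ s ∈ 𝓔, ∃ i, ε i = s := by
    intro s hs
    by_cases h1 : s = e₁
    · exact ⟨Sum.inl true, h1.symm⟩
    by_cases h2 : s = e₂
    · exact ⟨Sum.inl false, h2.symm⟩
    refine ⟨Sum.inr (r.symm ⟨s, by simp [h1, h2, hs]⟩), ?_⟩
    simp [hε]
  have hwε : ∀ i, w ∈ ε i ↔ i.isLeft := by
    intro i
    rw [hw _ (hmem i)]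
    rcases i with b | j
    · cases b <;> simp [hε]
    · simpa [hε] using ⟨hr1 j, hr2 j⟩
  have hg : ∀ v, ∃ i, v ∈ ε i := by
    intro v
    obtain ⟨e, he, hv⟩ := hcov v
    obtain ⟨i, rfl⟩ := hsurj e he
    exact ⟨i, hv⟩
  choose g hg using hg
  have huniq' : ∀ v i, v ≠ u → v ≠ w → (v ∈ ε i ↔ g v = i) := by
    intro v i hvu hvw
    constructor
    · intro hv
      exact hinj (huniq _ (hmem _) _ (hmem _) v (hg v) hv hvu hvw)
    · rintro rfl
      exact hg v
  set κ : V → Option (Option (Bool ⊕ Fin (m - 2))) := fun v =>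
    if v = u then none else if v = w then some none else some (some (g v)) with hκ
  refine ⟨ε, κ, fun s => ⟨hsurj s, ?_⟩, ?_, ?_⟩
  · rintro ⟨i, rfl⟩
    exact hmem i
  · intro i v
    by_cases hvu : v = u
    · simp [hκ, hvu, ExtremalIncidence, hu _ (hmem i)]
    by_cases hvw : v = w
    · simp only [hκ, hvw, huw.symm, if_true, if_false, ExtremalIncidence]
      exact hwε i
    · simp only [hκ, hvu, hvw, if_false, ExtremalIncidence]
      exact huniq' v i hvu hvw
  -- Erasing `w` removes a vertex only from `e₁` and `e₂`, whence `k - 2` there and `k - 1` for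
  -- pendant edges.
  · have hfib : ∀ i, univ.filter (fun v => κ v = some (some i)) = ((ε i).erase u).erase w := by
      intro i
      ext v
      simp only [Finset.mem_filter, mem_univ, true_and, mem_erase]
      by_cases hvu : v = u
      · simp [hκ, hvu]
      by_cases hvw : v = w
      · simp [hκ, hvw, huw.symm]
      · simp [hκ, hvu, hvw, huniq' v i hvu hvw]
    rintro (_ | _ | b | j)
    · rw [show univ.filter (fun v => κ v = none) = {u} from ?_, card_singleton]
      · rfl
      · ext v
        by_cases hvu : v = u <;> by_cases hvw : v = w <;> simp [hκ, hvu, hvw]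
    · rw [show univ.filter (fun v => κ v = some none) = {w} from ?_, card_singleton]
      · rfl
      · ext v
        by_cases hvw : v = w
        · simp [hκ, hvw, huw.symm]
        · by_cases hvu : v = u
          · simp [hκ, hvu, huw]
          · simp [hκ, hvu, hvw]
    · rw [hfib, card_erase_of_mem (mem_erase.2 ⟨huw.symm, (hwε _).2 rfl⟩),
        card_erase_of_mem (hu _ (hmem _)), hcard _ (hmem _)]
      rfl
    · rw [hfib, erase_eq_of_notMem, card_erase_of_mem (hu _ (hmem _)), hcard _ (hmem _)]
      · rfl
      · intro h'
        have := (hwε _).1 (mem_erase.1 h').2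
        simp at this

theorem IsExtremal.exists_equiv [Fintype V] [DecidableEq V] [Fintype W] [DecidableEq W]
    (h : 𝓔.IsExtremal k m) (h' : 𝓕.IsExtremal k m) :
    ∃ σ : V ≃ W, ∀ s, s ∈ 𝓔 ↔ s.map σ.toEmbedding ∈ 𝓕 := by
  obtain ⟨ε, κ, hε, hinc, hκ⟩ := h.exists_colouring
  obtain ⟨ε', κ', hε', hinc', hκ'⟩ := h'.exists_colouring
  have hfib : ∀ c, Nonempty ({v // κ v = c} ≃ {v // κ' v = c}) := by
    intro c
    refine ⟨Fintype.equivOfCardEq ?_⟩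
    rw [Fintype.card_subtype, Fintype.card_subtype, hκ, hκ']
  set σ := Equiv.ofFiberEquiv fun c => (hfib c).some with hσ
  have hσκ : ∀ v, κ' (σ v) = κ v := fun v => Equiv.ofFiberEquiv_map _ v
  have hmap : ∀ i, (ε i).map σ.toEmbedding = ε' i := by
    intro i
    ext v
    rw [Finset.mem_map_equiv, hinc, hinc', ← hσκ, Equiv.apply_symm_apply]
  refine ⟨σ, fun s => ?_⟩
  rw [hε, hε']
  refine exists_congr fun i => ?_
  rw [← hmap i, (Finset.map_injective _).eq_iff]

end Finset

namespace Hypergraph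

theorem isIsomorphic_iff {α β : Type*} (G : Hypergraph α) (H : Hypergraph β)
    [Fintype G.vertexSet] [Fintype H.vertexSet] :
    G.IsIsomorphic H ↔ ∃ σ : G.vertexSet ≃ H.vertexSet, ∀ s : Finset G.vertexSet,
      s ∈ G.finsetEdges ↔ s.map σ.toEmbedding ∈ H.finsetEdges := by
  refine exists_congr fun σ => ⟨fun h s => ?_, fun h s => ?_⟩
  · rw [mem_finsetEdges, mem_finsetEdges, h, Finset.coe_map]
    rfl
  · have := h s.toFinite.toFinset
    rw [mem_finsetEdges, mem_finsetEdges, Finset.coe_map, Set.Finite.coe_toFinset] at this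
    exact this

end Hypergraph

/-! ### The hypergraph `U_{m,2}` satisfies the description -/

namespace Hypergraph

theorem isExtremal_finsetEdges {α : Type*} (G : Hypergraph α) [Fintype G.vertexSet] {k m : ℕ}
    (hunif : G.IsUniform k) (hm : G.edgeSet.ncard = m)
    (hcov : ∀ v ∈ G.vertexSet, ∃ e ∈ G.edgeSet, v ∈ e) {u w : α} (huw : u ≠ w) {e₁ e₂ : Set α}
    (he₁ : e₁ ∈ G.edgeSet) (he₂ : e₂ ∈ G.edgeSet) (hne : e₁ ≠ e₂) (hu : ∀ e ∈ G.edgeSet, u ∈ e)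
    (hw : ∀ e ∈ G.edgeSet, w ∈ e ↔ e = e₁ ∨ e = e₂)
    (huniq : ∀ e ∈ G.edgeSet, ∀ f ∈ G.edgeSet, ∀ v ∈ e, v ∈ f → v ≠ u → v ≠ w → e = f) :
    G.finsetEdges.IsExtremal k m := by
  have huV : u ∈ G.vertexSet := G.subset_vertexSet_of_mem_edgeSet he₁ (hu _ he₁)
  have hwV : w ∈ G.vertexSet :=
    G.subset_vertexSet_of_mem_edgeSet he₁ ((hw _ he₁).2 (Or.inl rfl))
  have hmem : ∀ {v : G.vertexSet} {s : Finset G.vertexSet},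
      v ∈ s ↔ (v : α) ∈ Subtype.val '' (s : Set G.vertexSet) := by
    intro v s
    simp
  obtain ⟨s₁, hs₁, rfl⟩ := G.exists_finsetEdges he₁
  obtain ⟨s₂, hs₂, rfl⟩ := G.exists_finsetEdges he₂
  refine ⟨fun e he => G.card_of_mem_finsetEdges hunif he, by rw [card_finsetEdges, hm], ?_,
    ⟨u, huV⟩, ⟨w, hwV⟩, fun h => huw (congrArg Subtype.val h), s₁, hs₁, s₂, hs₂,
    fun h => hne (by rw [h]), ?_, ?_, ?_⟩
  · intro v
    obtain ⟨e, he, hv⟩ := hcov v v.2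
    obtain ⟨s, hs, rfl⟩ := G.exists_finsetEdges he
    exact ⟨s, hs, hmem.2 hv⟩
  · intro s hs
    exact hmem.2 (hu _ (G.mem_finsetEdges.1 hs))
  · intro s hs
    rw [hmem, hw _ (G.mem_finsetEdges.1 hs), G.image_val_injective.eq_iff,
      G.image_val_injective.eq_iff]
  · intro s hs t ht v hvs hvt hvu hvw
    exact G.image_val_injective (huniq _ (G.mem_finsetEdges.1 hs) _ (G.mem_finsetEdges.1 ht) v
      (hmem.1 hvs) (hmem.1 hvt) (fun h => hvu (Subtype.ext h)) fun h => hvw (Subtype.ext h))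

section Extremal

theorem ncard_image_natCast_add {N n : ℕ} (h : n < N) (a : ℕ) :
    ((fun t : ℕ => ((a + t : ℕ) : ZMod N)) '' Set.Iic n).ncard = n + 1 := by
  rw [Set.InjOn.ncard_image]
  · rw [← Finset.coe_Iic, Set.ncard_coe_finset, Nat.card_Iic]
  · intro s hs t ht hst
    simp only [Set.mem_Iic, Nat.cast_add, add_right_inj] at hs ht hst
    have := congrArg ZMod.val hst
    rwa [ZMod.val_natCast_of_lt (by omega), ZMod.val_natCast_of_lt (by omega)] at this

theorem image_natCast_first {n : ℕ} (hn : 0 < n) :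
    (fun t : ℕ => ((0 * n + t : ℕ) : ZMod (2 * n))) '' Set.Iic n =
      {x | x.val ≤ n} := by
  have : NeZero (2 * n) := ⟨by omega⟩
  ext x
  simp only [zero_mul, zero_add, Set.mem_image, Set.mem_Iic, Set.mem_ofPred_eq]
  constructor
  · rintro ⟨t, ht, rfl⟩
    rwa [ZMod.val_natCast_of_lt (by omega)]
  · intro hx
    exact ⟨x.val, hx, ZMod.natCast_zmod_val x⟩

theorem image_natCast_second {n : ℕ} (hn : 0 < n) :
    (fun t : ℕ => ((1 * n + t : ℕ) : ZMod (2 * n))) '' Set.Iic n =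
      {x | n ≤ x.val ∨ x.val = 0} := by
  have : NeZero (2 * n) := ⟨by omega⟩
  ext x
  simp only [one_mul, Set.mem_image, Set.mem_Iic, Set.mem_ofPred_eq]
  constructor
  · rintro ⟨t, ht, rfl⟩
    rw [ZMod.val_natCast]
    rcases ht.lt_or_eq with h | rfl
    · rw [Nat.mod_eq_of_lt (by omega)]
      omega
    -- The last vertex of the second edge wraps around to `0`.
    · rw [← two_mul, Nat.mod_self]
      exact Or.inr rfl
  · have hlt := ZMod.val_lt x
    rintro (hx | hx)
    · refine ⟨x.val - n, by omega, ?_⟩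
      rw [Nat.add_sub_cancel' hx, ZMod.natCast_zmod_val]
    · refine ⟨n, le_rfl, ?_⟩
      rw [(ZMod.val_eq_zero x).1 hx, ← two_mul, ZMod.natCast_self]

theorem mem_edgeSet_hypercycle_two {k : ℕ} (hk : 3 ≤ k) {e : Set (ZMod (2 * (k - 1)))} :
    e ∈ (hypercycle 2 k).edgeSet ↔ e = {x | x.val ≤ k - 1} ∨ e = {x | k - 1 ≤ x.val ∨ x.val = 0} := by
  rw [← image_natCast_first (by omega), ← image_natCast_second (by omega)]
  constructor
  · rintro ⟨i, hi, rfl⟩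
    interval_cases i
    · exact Or.inl rfl
    · exact Or.inr rfl
  · rintro (rfl | rfl)
    · exact ⟨0, by norm_num, rfl⟩
    · exact ⟨1, by norm_num, rfl⟩

theorem isUniform_extremalUnicyclic {k m g : ℕ} (hk : 3 ≤ k) (hg : 2 ≤ g) :
    (extremalUnicyclic k m g).IsUniform k := by
  rintro e (⟨f, ⟨i, -, rfl⟩, rfl⟩ | ⟨j, rfl⟩)
  · rw [Set.ncard_image_of_injective _ Sum.inl_injective, ncard_image_natCast_add]
    · omega
    · nlinarith [show 0 < k - 1 by omega]
  · rw [Set.ncard_insert_of_notMem (by simp), ← Set.image_univ, Set.ncard_image_of_injective,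
      Set.ncard_univ, Nat.card_eq_fintype_card, Fintype.card_fin]
    · omega
    · intro s t h
      simpa using h

theorem mem_edgeSet_extremalUnicyclic_two {k m : ℕ} (hk : 3 ≤ k)
    {e : Set (ZMod (2 * (k - 1)) ⊕ Fin (m - 2) × Fin (k - 1))} :
    e ∈ (extremalUnicyclic k m 2).edgeSet ↔ e = Sum.inl '' {x | x.val ≤ k - 1} ∨
      e = Sum.inl '' {x | k - 1 ≤ x.val ∨ x.val = 0} ∨
      ∃ j, e = insert (Sum.inl 0) (Set.range fun s => Sum.inr (j, s)) := by
  rw [← or_assoc]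
  refine or_congr ?_ Iff.rfl
  constructor
  · rintro ⟨f, hf, rfl⟩
    exact ((mem_edgeSet_hypercycle_two hk).1 hf).imp (congrArg _) (congrArg _)
  · rintro (rfl | rfl)
    · exact ⟨_, (mem_edgeSet_hypercycle_two hk).2 (Or.inl rfl), rfl⟩
    · exact ⟨_, (mem_edgeSet_hypercycle_two hk).2 (Or.inr rfl), rfl⟩

/-- The roles of `u` and `w` are played by the cycle vertices `0` and `k - 1`, the only ones common
to both edges of the hypercycle. -/
theorem isExtremal_extremalUnicyclic {k m : ℕ} (hk : 3 ≤ k) (hm : 2 ≤ m)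
    [Fintype (extremalUnicyclic k m 2).vertexSet] :
    (extremalUnicyclic k m 2).finsetEdges.IsExtremal k m := by
  have hN : NeZero (2 * (k - 1)) := ⟨by omega⟩
  have hone : (1 : ZMod (2 * (k - 1))).val = 1 := by
    have := ZMod.val_natCast_of_lt (n := 2 * (k - 1)) (a := 1) (by omega)
    rwa [Nat.cast_one] at this
  have hkv : ((k - 1 : ℕ) : ZMod (2 * (k - 1))).val = k - 1 :=
    ZMod.val_natCast_of_lt (by omega)
  have hne : (Sum.inl '' {x : ZMod (2 * (k - 1)) | x.val ≤ k - 1} :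
      Set (ZMod (2 * (k - 1)) ⊕ Fin (m - 2) × Fin (k - 1))) ≠
      Sum.inl '' {x | k - 1 ≤ x.val ∨ x.val = 0} := by
    intro h
    -- The vertex `1` lies only in the first edge because `1 < k - 1`; this is where `k ≥ 3`
    -- matters.
    have h1 : (1 : ZMod (2 * (k - 1))) ∈ {x : ZMod (2 * (k - 1)) | x.val ≤ k - 1} := by
      rw [Set.mem_ofPred_eq, hone]
      omega
    rw [Set.image_injective.2 Sum.inl_injective h, Set.mem_ofPred_eq, hone] at h1
    omega
  set P : Fin (m - 2) → Set (ZMod (2 * (k - 1)) ⊕ Fin (m - 2) × Fin (k - 1)) :=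
    fun j => insert (Sum.inl 0) (Set.range fun s => Sum.inr (j, s)) with hP
  have hmemP : ∀ {j i s}, (Sum.inr (i, s)) ∈ P j ↔ i = j := by
    intro j i s
    simp only [hP, Set.mem_insert_iff, reduceCtorEq, false_or, Set.mem_range, Sum.inr.injEq,
      Prod.mk.injEq]
    exact ⟨fun ⟨_, h, _⟩ => h.symm, fun h => ⟨s, h.symm, rfl⟩⟩
  have hmemP' : ∀ {j x}, (Sum.inl x) ∈ P j ↔ x = 0 := by
    intro j x
    simp [hP]
  have hPinj : Function.Injective P := by
    intro i j hij
    have : Sum.inr (i, ⟨0, by omega⟩) ∈ P j := hij ▸ hmemP.2 rfl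
    exact hmemP.1 this
  have hPne : ∀ j (s : Set (ZMod (2 * (k - 1)))), P j ≠ Sum.inl '' s := by
    intro j s h
    have : Sum.inr (j, ⟨0, by omega⟩) ∈ P j := hmemP.2 rfl
    rw [h] at this
    simp at this
  refine isExtremal_finsetEdges _ (isUniform_extremalUnicyclic hk le_rfl) ?_ ?_
    (u := Sum.inl 0) (w := Sum.inl ((k - 1 : ℕ) : ZMod (2 * (k - 1)))) ?_
    ((mem_edgeSet_extremalUnicyclic_two hk).2 (Or.inl rfl))
    ((mem_edgeSet_extremalUnicyclic_two hk).2 (Or.inr (Or.inl rfl))) hne ?_ ?_ ?_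
  · have : (extremalUnicyclic k m 2).edgeSet =
        {Sum.inl '' {x | x.val ≤ k - 1}, Sum.inl '' {x | k - 1 ≤ x.val ∨ x.val = 0}} ∪
          Set.range P := by
      ext e
      rw [mem_edgeSet_extremalUnicyclic_two hk, ← or_assoc]
      refine or_congr Iff.rfl ?_
      simp [hP, eq_comm]
    rw [this, Set.ncard_union_eq, Set.ncard_pair hne, ← Set.image_univ,
      Set.ncard_image_of_injective _ hPinj, Set.ncard_univ, Nat.card_eq_fintype_card,
      Fintype.card_fin]
    · omega
    · rw [Set.disjoint_left]
      rintro _ (rfl | rfl) ⟨j, hj⟩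
      · exact hPne _ _ hj
      · exact hPne _ _ hj
  · rintro (x | ⟨j, s⟩) -
    · by_cases hx : x.val ≤ k - 1
      · exact ⟨_, (mem_edgeSet_extremalUnicyclic_two hk).2 (Or.inl rfl), x, hx, rfl⟩
      · exact ⟨_, (mem_edgeSet_extremalUnicyclic_two hk).2 (Or.inr (Or.inl rfl)), x,
          Or.inl (by omega), rfl⟩
    · exact ⟨P j, (mem_edgeSet_extremalUnicyclic_two hk).2 (Or.inr (Or.inr ⟨j, rfl⟩)),
        hmemP.2 rfl⟩
  · intro h
    have := congrArg ZMod.val (Sum.inl_injective h)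
    rw [hkv, ZMod.val_zero] at this
    omega
  · intro e he
    rcases (mem_edgeSet_extremalUnicyclic_two hk).1 he with rfl | rfl | ⟨j, rfl⟩
    · exact ⟨0, by simp, rfl⟩
    · exact ⟨0, by simp, rfl⟩
    · exact Set.mem_insert _ _
  · intro e he
    rcases (mem_edgeSet_extremalUnicyclic_two hk).1 he with rfl | rfl | ⟨j, rfl⟩
    · exact iff_of_true ⟨_, hkv.le, rfl⟩ (Or.inl rfl)
    · exact iff_of_true ⟨_, Or.inl hkv.ge, rfl⟩ (Or.inr rfl)
    · refine iff_of_false (fun h => ?_) ?_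
      · have h0 := congrArg ZMod.val (hmemP'.1 h)
        rw [hkv, ZMod.val_zero] at h0
        omega
      · rintro (h | h)
        · exact hPne _ _ h
        · exact hPne _ _ h
  · have hC : ∀ x : ZMod (2 * (k - 1)), (Sum.inl x :
        ZMod (2 * (k - 1)) ⊕ Fin (m - 2) × Fin (k - 1)) ≠ Sum.inl 0 →
        (Sum.inl x : ZMod (2 * (k - 1)) ⊕ Fin (m - 2) × Fin (k - 1)) ≠
          Sum.inl ((k - 1 : ℕ) : ZMod (2 * (k - 1))) → x.val ≤ k - 1 →
        (k - 1 ≤ x.val ∨ x.val = 0) → False := by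
      intro x hx0 hxk h1 h2
      have hx0' : x.val ≠ 0 := fun h => hx0 (congrArg _ ((ZMod.val_eq_zero x).1 h))
      have hxk' : x.val ≠ k - 1 := fun h => hxk <| congrArg Sum.inl <|
        (ZMod.natCast_zmod_val x).symm.trans (congrArg (Nat.cast : ℕ → ZMod (2 * (k - 1))) h)
      omega
    have hinl : ∀ {S : Set (ZMod (2 * (k - 1)))} {x}, (Sum.inl x :
        ZMod (2 * (k - 1)) ⊕ Fin (m - 2) × Fin (k - 1)) ∈ Sum.inl '' S → x ∈ S :=
      fun h => (Sum.inl_injective.mem_set_image).1 h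
    intro e he f hf v hve hvf hvu hvw
    rcases (mem_edgeSet_extremalUnicyclic_two hk).1 he with rfl | rfl | ⟨i, rfl⟩ <;>
      rcases (mem_edgeSet_extremalUnicyclic_two hk).1 hf with rfl | rfl | ⟨j, rfl⟩
    · rfl
    · obtain ⟨x, hx, rfl⟩ := hve
      exact (hC x hvu hvw hx (hinl hvf)).elim
    · obtain ⟨x, hx, rfl⟩ := hve
      exact absurd (congrArg _ (hmemP'.1 hvf)) hvu
    · obtain ⟨x, hx, rfl⟩ := hve
      exact (hC x hvu hvw (hinl hvf) hx).elim
    · rfl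
    · obtain ⟨x, hx, rfl⟩ := hve
      exact absurd (congrArg _ (hmemP'.1 hvf)) hvu
    · obtain ⟨x, hx, rfl⟩ := hvf
      exact absurd (congrArg _ (hmemP'.1 hve)) hvu
    · obtain ⟨x, hx, rfl⟩ := hvf
      exact absurd (congrArg _ (hmemP'.1 hve)) hvu
    · rcases v with x | ⟨l, s⟩
      · exact absurd (congrArg _ (hmemP'.1 hve)) hvu
      · rw [← hmemP.1 hve, ← hmemP.1 hvf]

end Extremal

end Hypergraph

/-! ### The main theorem -/

theorem mainTheorem4 {α : Type*} (k m : ℕ) (hk : 3 ≤ k) (hm : 2 ≤ m)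
    (G : Hypergraph α) [Fintype G.vertexSet]
    (hunif : G.IsUniform k) (hsize : G.edgeSet.ncard = m) (hG : G.IsUnicyclic) :
    G.abcSpectralRadius k ≤ ((m : ℝ) - 1 + 2 / m) ^ ((1 : ℝ) / k) ∧
      (G.abcSpectralRadius k = ((m : ℝ) - 1 + 2 / m) ^ ((1 : ℝ) / k) ↔
        G.IsIsomorphic (Hypergraph.extremalUnicyclic k m 2)) := by
  classical
  have hm' : (2 : ℝ) ≤ m := by exact_mod_cast hm
  have hL : 0 < (m : ℝ) - 1 + 2 / m := by
    have : (0 : ℝ) < 2 / m := by positivity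
    linarith
  have : NeZero (2 * (k - 1)) := ⟨by omega⟩
  have : Fintype (Hypergraph.extremalUnicyclic k m 2).vertexSet := Fintype.ofFinite _
  have hU := Hypergraph.isExtremal_extremalUnicyclic hk hm
  have hcard := G.card_finsetEdges.trans hsize
  have hiso : G.IsIsomorphic (Hypergraph.extremalUnicyclic k m 2) ↔
      G.finsetEdges.IsExtremal k m := by
    rw [Hypergraph.isIsomorphic_iff]
    constructor
    · rintro ⟨σ, hσ⟩
      refine hU.map_equiv σ.symm fun s => ?_
      rw [hσ, Finset.map_map]
      simp
    · intro h
      exact h.exists_equiv hU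
  have hcov := hG.1.exists_finsetEdges_mem (by omega) hunif
    (Finset.card_pos.1 (by omega : 0 < G.finsetEdges.card))
  rw [hiso]
  -- The extremal case gives equality and every other case a strict labelling, so the bound and its
  -- equality case follow together.
  by_cases hext : G.finsetEdges.IsExtremal k m
  · have := G.abcSpectralRadius_of_isExtremal hk hm hunif hext
    exact ⟨this.le, iff_of_true this hext⟩
  · have hlt := G.abcSpectralRadius_lt_of_hasStrictLabelling (by omega) hunif hL
      ((hG.hasFewCycles.hasStrictLabelling_or_isExtremal
        (fun e he => G.card_of_mem_finsetEdges hunif he) hcard hm hcov).resolve_right hext)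
    exact ⟨hlt.le, iff_of_false hlt.ne hext⟩
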